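/- Let $K$ be a commutative ring, $H$ a Hopf $K$-algebra, $A$ a right $H$-comodule $K$-algebra with coaction $a\mapsto\sum a_{0}\otimes a_{1}$ (a coassociative, counital algebra map $A\to A\otimes_K H$), and $C$ a left $H$-module $K$-coalgebra (the action $H\otimes_K C\to C$ is a coalgebra map). Let $C^*=\mathrm{Hom}_K(C,K)$ with the convolution product $(xy)(c)=\sum x(c_{1})y(c_{2})$ and the right $H$-action $(xh)(c)=x(hc)$. The smash product $A\sharp C^*$ is $A\otimes_K C^*$ with product $(a\sharp x)(b\sharp y)=\sum ab_{0}\sharp (xb_{1})y$ and unit $1\sharp\varepsilon$. For a left $C^*$-module $X$, let $\mathrm{Rat}_C(X)$ be the submodule of those $m\in X$ for which there are finitely many $c_i\in C$, $m_i\in X$ with $xm=\sum_i x(c_i)m_i$ for all $x\in C^*$. Assume that $C$ is locally projective over $K$, that $A$ is flat over $K$, and that the functor $\mathrm{Rat}_C$ on left $C^*$-modules is exact. A Doi-Koppinen module is a left $A$-module $M$ with a right $C$-comodule structure $\rho$ such that $\rho(am)=\sum a_{0}m_{0}\otimes a_{1}m_{1}$; morphisms are the left $A$-linear, right $C$-colinear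 maps. Such an $M$ is a left $A\sharp C^*$-module by $(a\sharp x)m=\sum x(m_{1})\,am_{0}$. Let $\mathfrak a$ be the two-sided ideal of rational elements of $A\sharp C^*$ (as a left $C^*$-module). For each Doi-Koppinen module $E$ the map $\mathrm{Hom}_{A\sharp C^*}(\mathfrak a,E)\to \mathrm{Hom}_{C^*}(\mathrm{Rat}_C(C^*),E)$, $f\mapsto (r\mapsto f(1\sharp r))$, is bijective; give the target the left $A\sharp C^*$-module structure transferred along it from $(bf)(u)=f(ub)$. Let $M$ be a Doi-Koppinen module. Then $M$ has an injective hull in the category of Doi-Koppinen modules, and for every such injective hull $j:M\to E(M)$: (a) The map $\zeta_M:M\to \mathrm{Hom}_{C^*}(\mathrm{Rat}_C(C^*),E(M))$, $\zeta_M(m)(r)=r\,j(m)$, is an injective envelope of $M$ in the category of left $A\sharp C^*$-modules. (b) $M$ is injective as a left $A\sharp C^*$-module if and only if $M$ is injective in the category of Doi-Koppinen modules and $\zeta_M$ is an isomorphism. (c) Assume that the antipode of $H$ is bijective and that $C^*$ is flat over $K$. If $M$ is injective in the category of Doi-Koppinen modules and $M$ has finite support as a right $C$-comodule, then $M$ is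 injective as a left $A$-module. Here finite support means: $\mathrm{Rat}_C(C^*)$ contains a set $\mathcal E$ of local units (commuting idempotents such that each $x\in\mathrm{Rat}_C(C^*)$ satisfies $ex=xe=x$ for some $e\in \mathcal E$) and there is a finite subset $F\subseteq \mathcal E$ with $\bigl(\sum_{e\in F}e\bigr)m=m$ for all $m\in M$. -/

import Mathlib

open TensorProduct CategoryTheory

universe u

set_option linter.unusedSectionVars false

noncomputable section

namespace DoiKoppinen

/-- The convolution algebra `C* = Hom_K(C, K)` of a coalgebra `C`:
`(x * y)(c) = ∑ x(c₁) y(c₂)`, with unit the counit. -/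
abbrev ConvDual (K C : Type u) [CommRing K] [AddCommGroup C] [Module K C] : Type u :=
  WithConv (C →ₗ[K] K)

/-- The multiplication map `R ⊗ M → M` of a module over a `K`-algebra `R`. -/
abbrev actMap (K R M : Type u) [CommRing K] [Ring R] [Algebra K R] [AddCommGroup M] [Module K M]
    [Module R M] [IsScalarTower K R M] : R ⊗[K] M →ₗ[K] M :=
  TensorProduct.lift (Algebra.lsmul K K M : R →ₐ[K] Module.End K M).toLinearMap

/-- The diagonal action `(r ⊗ s) · (m ⊗ n) = (r m) ⊗ (s n)` of `R ⊗ S` on `M ⊗ N`. -/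
def diagAct (K R S M N : Type u) [CommRing K] [Ring R] [Algebra K R] [Ring S] [Algebra K S]
    [AddCommGroup M] [Module K M] [Module R M] [IsScalarTower K R M]
    [AddCommGroup N] [Module K N] [Module S N] [IsScalarTower K S N] :
    R ⊗[K] S →ₗ[K] M ⊗[K] N →ₗ[K] M ⊗[K] N :=
  TensorProduct.curry (TensorProduct.map (actMap K R M) (actMap K S N) ∘ₗ
    (TensorProduct.tensorTensorTensorComm K R S M N).toLinearMap)

theorem diagAct_tmul {K R S M N : Type u} [CommRing K] [Ring R] [Algebra K R] [Ring S]
    [Algebra K S] [AddCommGroup M] [Module K M] [Module R M] [IsScalarTower K R M]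
    [AddCommGroup N] [Module K N] [Module S N] [IsScalarTower K S N]
    (r : R) (s : S) (m : M) (n : N) :
    diagAct K R S M N (r ⊗ₜ s) (m ⊗ₜ n) = (r • m) ⊗ₜ (s • n) := rfl

/-- A right `H`-comodule algebra: an algebra `A` with a coassociative and counital coaction
`ρ : A → A ⊗ H` that is a homomorphism of algebras. -/
class RightComoduleAlgebra (K H A : Type u) [CommRing K] [Ring H] [Bialgebra K H]
    [Ring A] [Algebra K A] where
  coact : A →ₐ[K] A ⊗[K] H
  coassoc : (TensorProduct.assoc K A H H).toLinearMap ∘ₗ coact.toLinearMap.rTensor H ∘ₗ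
      coact.toLinearMap = (Coalgebra.comul (R := K) (A := H)).lTensor A ∘ₗ coact.toLinearMap
  counit_coact : (TensorProduct.rid K A).toLinearMap ∘ₗ
      (Coalgebra.counit (R := K) (A := H)).lTensor A ∘ₗ coact.toLinearMap = LinearMap.id

/-- A left `H`-module coalgebra: a coalgebra `C` with a left `H`-module structure whose
action map `H ⊗ C → C` is a homomorphism of coalgebras. -/
class LeftModuleCoalgebra (K H C : Type u) [CommRing K] [Ring H] [Bialgebra K H]
    [AddCommGroup C] [Module K C] [Coalgebra K C] [Module H C] [IsScalarTower K H C] : Prop where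
  comul_smul : ∀ (h : H) (c : C), Coalgebra.comul (R := K) (h • c) =
      diagAct K H H C C (Coalgebra.comul (R := K) h) (Coalgebra.comul (R := K) c)
  counit_smul : ∀ (h : H) (c : C), Coalgebra.counit (R := K) (h • c) =
      Coalgebra.counit (R := K) h * Coalgebra.counit (R := K) c

/-- Local projectivity: for every `K`-linear surjection `g : L → N`, every `K`-linear
`f : P → N` and every finitely generated `F ≤ P`, some `h : P → L` satisfies `g ∘ h = f` on `F`. -/
def IsLocallyProjective (K P : Type u) [CommRing K] [AddCommGroup P] [Module K P] : Prop :=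
  ∀ (L N : Type u) [AddCommGroup L] [Module K L] [AddCommGroup N] [Module K N]
    (g : L →ₗ[K] N) (_ : Function.Surjective g) (f : P →ₗ[K] N)
    (F : Submodule K P) (_ : F.FG), ∃ h : P →ₗ[K] L, ∀ p ∈ F, g (h p) = f p

section Rational

variable (K C : Type u) [CommRing K] [AddCommGroup C] [Module K C] [Coalgebra K C]

/-- `m` is rational: there are finitely many `cᵢ ∈ C`, `mᵢ ∈ X` with `x m = ∑ x(cᵢ) mᵢ` for all
`x ∈ C*`. A left `C*`-module is regarded as a `K`-module through `K → C*`. -/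
def IsRational {X : Type u} [AddCommGroup X] [Module (ConvDual K C) X] (m : X) : Prop :=
  ∃ (n : ℕ) (c : Fin n → C) (m' : Fin n → X), ∀ x : ConvDual K C,
    x • m = ∑ i, algebraMap K (ConvDual K C) (x (c i)) • m' i

variable {K C}

/-- `φ : C* → X` has the form `x ↦ ∑ x(cᵢ) mᵢ` (a finite sum). -/
def HasParams {X : Type u} [AddCommGroup X] [Module (ConvDual K C) X]
    (φ : ConvDual K C → X) : Prop :=
  ∃ (n : ℕ) (c : Fin n → C) (m' : Fin n → X), ∀ x : ConvDual K C,
    φ x = ∑ i, algebraMap K (ConvDual K C) (x (c i)) • m' i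

theorem HasParams.of_sum {X : Type u} [AddCommGroup X] [Module (ConvDual K C) X]
    {φ : ConvDual K C → X} {ι : Type*} (s : Finset ι) (c : ι → C) (m' : ι → X)
    (h : ∀ x : ConvDual K C, φ x = ∑ i ∈ s, algebraMap K (ConvDual K C) (x (c i)) • m' i) :
    HasParams φ := by
  refine ⟨s.card, fun i => c (s.equivFin.symm i), fun i => m' (s.equivFin.symm i), fun x => ?_⟩
  rw [h x, ← Finset.sum_coe_sort s]
  exact (Equiv.sum_comp s.equivFin.symm
    (fun i : s => algebraMap K (ConvDual K C) (x (c i)) • m' i)).symm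

theorem HasParams.zero {X : Type u} [AddCommGroup X] [Module (ConvDual K C) X] :
    HasParams (fun _ : ConvDual K C => (0 : X)) :=
  ⟨0, Fin.elim0, Fin.elim0, fun x => by simp⟩

theorem HasParams.add {X : Type u} [AddCommGroup X] [Module (ConvDual K C) X]
    {φ ψ : ConvDual K C → X} (hm : HasParams φ) (hn : HasParams ψ) :
    HasParams (fun x => φ x + ψ x) := by
  obtain ⟨k, c, m', h⟩ := hm
  obtain ⟨l, d, n', h'⟩ := hn
  refine HasParams.of_sum (Finset.univ : Finset (Fin k ⊕ Fin l)) (Sum.elim c d)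
    (Sum.elim m' n') fun x => ?_
  simp [h x, h' x]

theorem IsRational.zero {X : Type u} [AddCommGroup X] [Module (ConvDual K C) X] :
    IsRational K C (0 : X) :=
  ⟨0, Fin.elim0, Fin.elim0, fun x => by simp⟩

theorem IsRational.add {X : Type u} [AddCommGroup X] [Module (ConvDual K C) X] {m n : X}
    (hm : IsRational K C m) (hn : IsRational K C n) : IsRational K C (m + n) := by
  obtain ⟨k, c, m', h⟩ := HasParams.add hm hn
  exact ⟨k, c, m', fun x => by rw [smul_add, ← h]⟩

theorem IsRational.map {X Y : Type u} [AddCommGroup X] [Module (ConvDual K C) X]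
    [AddCommGroup Y] [Module (ConvDual K C) Y] (f : X →ₗ[ConvDual K C] Y) {m : X}
    (hm : IsRational K C m) : IsRational K C (f m) := by
  obtain ⟨k, c, m', h⟩ := hm
  exact ⟨k, c, fun i => f (m' i), fun x => by rw [← map_smul, h x]; simp⟩

theorem IsRational.smul {X : Type u} [AddCommGroup X] [Module (ConvDual K C) X] {m : X}
    (y : ConvDual K C) (hm : IsRational K C m) : IsRational K C (y • m) := by
  obtain ⟨k, c, m', h⟩ := hm
  let r := fun i => Coalgebra.Repr.arbitrary K (c i)
  refine HasParams.of_sum (Finset.univ.sigma fun i => (r i).index)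
    (fun p => (r p.1).left p.2)
    (fun p => algebraMap K (ConvDual K C) (y ((r p.1).right p.2)) • m' p.1) fun x => ?_
  rw [smul_smul, h, Finset.sum_sigma]
  refine Finset.sum_congr rfl fun i _ => ?_
  rw [(r i).convMul_apply, map_sum, Finset.sum_smul]
  simp [smul_smul]

variable (K C)

/-- The rational submodule `Rat_C(X)` of a left `C*`-module `X`. -/
def rat (X : Type u) [AddCommGroup X] [Module (ConvDual K C) X] :
    Submodule (ConvDual K C) X where
  carrier := {m | IsRational K C m}
  zero_mem' := IsRational.zero
  add_mem' := IsRational.add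
  smul_mem' y _ hm := IsRational.smul y hm

variable {K C} in
/-- The action of the functor `Rat_C` on morphisms, by restriction. -/
def ratMap {X Y : Type u} [AddCommGroup X] [Module (ConvDual K C) X]
    [AddCommGroup Y] [Module (ConvDual K C) Y] (f : X →ₗ[ConvDual K C] Y) :
    rat K C X →ₗ[ConvDual K C] rat K C Y :=
  f.restrict fun _ hm => IsRational.map f hm

/-- The functor `Rat_C` on left `C*`-modules is exact. -/
def RatIsExact : Prop :=
  ∀ (X Y Z : Type u) [AddCommGroup X] [AddCommGroup Y] [AddCommGroup Z]
    [Module (ConvDual K C) X] [Module (ConvDual K C) Y] [Module (ConvDual K C) Z]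
    (f : X →ₗ[ConvDual K C] Y) (g : Y →ₗ[ConvDual K C] Z),
    Function.Exact f g → Function.Exact (ratMap f) (ratMap g)

/-- `E` is a set of local units for `Rat_C(C*)`: commuting idempotents of `Rat_C(C*)` such that
each `x ∈ Rat_C(C*)` satisfies `e x = x e = x` for some `e ∈ E`. -/
structure IsLocalUnits (E : Set (ConvDual K C)) : Prop where
  subset : ∀ e ∈ E, e ∈ rat K C (ConvDual K C)
  idem : ∀ e ∈ E, e * e = e
  comm : ∀ e ∈ E, ∀ e' ∈ E, e * e' = e' * e
  unit : ∀ x ∈ rat K C (ConvDual K C), ∃ e ∈ E, x * e = x ∧ e * x = x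

/-- A left `C*`-module `X` has finite support: `Rat_C(C*)` has a set `E` of local units with a
finite subset `F` whose sum acts as the identity on `X`. -/
def HasFiniteSupport (X : Type u) [AddCommGroup X] [Module (ConvDual K C) X] : Prop :=
  ∃ E : Set (ConvDual K C), IsLocalUnits K C E ∧
    ∃ F : Finset (ConvDual K C), (F : Set (ConvDual K C)) ⊆ E ∧ ∀ m : X, (∑ e ∈ F, e) • m = m

end Rational

section Smash

variable (K H A C : Type u) [CommRing K] [Ring H] [HopfAlgebra K H]
  [Ring A] [Algebra K A] [RightComoduleAlgebra K H A]
  [AddCommGroup C] [Module K C] [Coalgebra K C] [Module H C] [IsScalarTower K H C]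

/-- The right `H`-action on `C*`: `(x h)(c) = x(h c)`. -/
def dualAct : ConvDual K C →ₗ[K] H →ₗ[K] ConvDual K C :=
  LinearMap.mk₂ K
    (fun x h => WithConv.toConv (x.ofConv ∘ₗ (Algebra.lsmul K K C h : C →ₗ[K] C)))
    (fun x y h => by ext c; simp) (fun k x h => by ext c; simp)
    (fun x h h' => by ext c; simp) (fun k x h => by ext c; simp)

/-- For `x, y ∈ C*`, the map `h ↦ (x h) * y`. -/
def twist : ConvDual K C →ₗ[K] ConvDual K C →ₗ[K] H →ₗ[K] ConvDual K C :=
  LinearMap.mk₂ K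
    (fun x y => (LinearMap.mulRight K y) ∘ₗ dualAct K H C x)
    (fun x y h => LinearMap.ext fun c => by simp [add_mul])
    (fun k x h => LinearMap.ext fun c => by simp)
    (fun x h h' => LinearMap.ext fun c => by simp [mul_add])
    (fun k x y => LinearMap.ext fun c => mul_smul_comm k _ y)

/-- For `a ∈ A`, `x ∈ C*`, the map `b ⊗ y ↦ ∑ a b₀ ⊗ (x b₁) y`. -/
def smashMulLeft (a : A) (x : ConvDual K C) : A ⊗[K] ConvDual K C →ₗ[K] A ⊗[K] ConvDual K C :=
  TensorProduct.lift <| LinearMap.mk₂ K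
    (fun b y => TensorProduct.map (LinearMap.mulLeft K a) (twist K H C x y)
      (RightComoduleAlgebra.coact (K := K) (H := H) b))
    (fun b b' y => by simp) (fun k b y => by simp)
    (fun b y y' => by simp [TensorProduct.map_add_right])
    (fun k b y => by simp [TensorProduct.map_smul_right])

/-- The product `(a ⊗ x)(b ⊗ y) = ∑ a b₀ ⊗ (x b₁) y` on `A ⊗ C*`. -/
def smashMul : A ⊗[K] ConvDual K C →ₗ[K] A ⊗[K] ConvDual K C →ₗ[K] A ⊗[K] ConvDual K C :=
  TensorProduct.lift <| LinearMap.mk₂ K (smashMulLeft K H A C)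
    (fun a a' x => by
      refine TensorProduct.ext' fun b y => ?_
      have : LinearMap.mulLeft K (a + a') = LinearMap.mulLeft K a + LinearMap.mulLeft K a' := by
        ext; simp [add_mul]
      simp [smashMulLeft, this, TensorProduct.map_add_left])
    (fun k a x => by
      refine TensorProduct.ext' fun b y => ?_
      have : LinearMap.mulLeft K (k • a) = k • LinearMap.mulLeft K a := by ext; simp
      simp [smashMulLeft, this, TensorProduct.map_smul_left])
    (fun a x x' => by
      refine TensorProduct.ext' fun b y => ?_
      simp [smashMulLeft, TensorProduct.map_add_right])
    (fun a k x => by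
      refine TensorProduct.ext' fun b y => ?_
      simp [smashMulLeft, TensorProduct.map_smul_right])

variable {A C} in
theorem smashMul_tmul (a b : A) (x y : ConvDual K C) :
    smashMul K H A C (a ⊗ₜ x) (b ⊗ₜ y) =
      TensorProduct.map (LinearMap.mulLeft K a) (twist K H C x y)
        (RightComoduleAlgebra.coact (K := K) (H := H) b) := rfl

variable {C} in
theorem twist_apply (x y : ConvDual K C) (h : H) :
    twist K H C x y h = dualAct K H C x h * y := rfl

variable {C} in
theorem dualAct_apply (x : ConvDual K C) (h : H) (c : C) :
    (dualAct K H C x h) c = x (h • c) := rfl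

variable {C} in
theorem dualAct_one (x : ConvDual K C) : dualAct K H C x 1 = x := by
  ext c; exact congrArg x (one_smul H c)

variable {C} in
theorem dualAct_mul (x : ConvDual K C) (h k : H) :
    dualAct K H C x (h * k) = dualAct K H C (dualAct K H C x h) k := by
  ext c; exact congrArg x (mul_smul h k c)

variable {C} in
theorem one_dualAct [LeftModuleCoalgebra K H C] (h : H) :
    dualAct K H C 1 h = Coalgebra.counit (R := K) h • (1 : ConvDual K C) := by
  ext c
  exact LeftModuleCoalgebra.counit_smul h c

variable {C} in
/-- `(x y) h = ∑ (x h₁) (y h₂)`. -/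
theorem mul_dualAct [LeftModuleCoalgebra K H C] (x y : ConvDual K C) (h : H) :
    dualAct K H C (x * y) h = LinearMap.mul' K (ConvDual K C)
      (TensorProduct.map (dualAct K H C x) (dualAct K H C y) (Coalgebra.comul (R := K) h)) := by
  ext c
  change LinearMap.mul' K K (TensorProduct.map x.ofConv y.ofConv
    (Coalgebra.comul (R := K) (h • c))) = _
  rw [LeftModuleCoalgebra.comul_smul]
  generalize Coalgebra.comul (R := K) h = t
  induction t with
  | zero => simp
  | add s t hs ht =>
    simp only [map_add, WithConv.ofConv_add, LinearMap.add_apply] at *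
    rw [hs, ht]
  | tmul h k =>
    simp only [TensorProduct.map_tmul, LinearMap.mul'_apply]
    change _ = LinearMap.mul' K K (TensorProduct.map (dualAct K H C x h).ofConv
      (dualAct K H C y k).ofConv (Coalgebra.comul (R := K) c))
    generalize Coalgebra.comul (R := K) c = w
    induction w with
    | zero => simp
    | add s t hs ht =>
      simp only [map_add] at *
      rw [hs, ht]
    | tmul c d => rfl

theorem smashMul_one_left [LeftModuleCoalgebra K H C] (u : A ⊗[K] ConvDual K C) :
    smashMul K H A C (1 ⊗ₜ 1) u = u := by
  induction u with
  | zero => simp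
  | add s t hs ht => rw [map_add, hs, ht]
  | tmul b y =>
    have h := LinearMap.congr_fun (RightComoduleAlgebra.counit_coact (K := K) (H := H) (A := A)) b
    simp only [LinearMap.comp_apply, LinearMap.id_apply] at h
    rw [smashMul_tmul]
    conv_rhs => rw [← h]
    change _ = TensorProduct.rid K A (LinearMap.lTensor A Coalgebra.counit
      (RightComoduleAlgebra.coact (K := K) (H := H) b)) ⊗ₜ[K] y
    generalize RightComoduleAlgebra.coact (K := K) (H := H) b = t
    induction t with
    | zero => simp
    | add s t hs ht => simp only [map_add, TensorProduct.add_tmul, hs, ht]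
    | tmul b h => simp [twist_apply, one_dualAct, TensorProduct.smul_tmul]

theorem smashMul_one_right (u : A ⊗[K] ConvDual K C) :
    smashMul K H A C u (1 ⊗ₜ 1) = u := by
  induction u with
  | zero => simp
  | add s t hs ht => rw [map_add, LinearMap.add_apply, hs, ht]
  | tmul b y =>
    rw [smashMul_tmul, map_one (RightComoduleAlgebra.coact (K := K) (H := H) (A := A)),
      Algebra.TensorProduct.one_def]
    simp [twist_apply, dualAct_one]

variable {A C} in
/-- Auxiliary map for associativity: `r ⊗ k ↦ ∑ a tᵣ₀ ⊗ (x tᵣ₁) (y k) z`, where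
`t r = ∑ tᵣ₀ ⊗ tᵣ₁`. -/
def smashAux (a : A) (x y z : ConvDual K C) (t : A ⊗[K] H) :
    (A ⊗[K] H) ⊗[K] H →ₗ[K] A ⊗[K] ConvDual K C :=
  TensorProduct.lift (LinearMap.mk₂ K
    (fun r k => TensorProduct.map (LinearMap.mulLeft K a)
      (twist K H C x (twist K H C y z k)) (t * r))
    (fun r r' k => by simp [mul_add]) (fun l r k => by simp)
    (fun r k k' => by simp [TensorProduct.map_add_right])
    (fun l r k => by simp [TensorProduct.map_smul_right]))

variable {A C} in
theorem smashAux_tmul (a : A) (x y z : ConvDual K C) (t r : A ⊗[K] H) (k : H) :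
    smashAux K H a x y z t (r ⊗ₜ k) = TensorProduct.map (LinearMap.mulLeft K a)
      (twist K H C x (twist K H C y z k)) (t * r) := rfl

variable {A C} in
theorem smashAux_add (a : A) (x y z : ConvDual K C) (t t' : A ⊗[K] H)
    (s : (A ⊗[K] H) ⊗[K] H) :
    smashAux K H a x y z (t + t') s = smashAux K H a x y z t s + smashAux K H a x y z t' s := by
  induction s with
  | zero => simp
  | add s s' hs hs' => rw [map_add, hs, hs', map_add, map_add]; abel
  | tmul r k => simp only [smashAux_tmul, add_mul, map_add]

variable {A C} in
theorem smashAux_zero (a : A) (x y z : ConvDual K C) (s : (A ⊗[K] H) ⊗[K] H) :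
    smashAux K H a x y z 0 s = 0 := by
  induction s with
  | zero => simp
  | add s s' hs hs' => rw [map_add, hs, hs', add_zero]
  | tmul r k => simp only [smashAux_tmul, zero_mul, map_zero]

theorem smashMul_assoc [LeftModuleCoalgebra K H C] (u v w : A ⊗[K] ConvDual K C) :
    smashMul K H A C (smashMul K H A C u v) w = smashMul K H A C u (smashMul K H A C v w) := by
  induction u with
  | zero => simp
  | add s t hs ht => simp only [map_add, LinearMap.add_apply, hs, ht]
  | tmul a x =>
  induction v with
  | zero => simp
  | add s t hs ht => simp only [map_add, LinearMap.add_apply, hs, ht]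
  | tmul b y =>
  induction w with
  | zero => simp
  | add s t hs ht => simp only [map_add, hs, ht]
  | tmul c z =>
    have hco := LinearMap.congr_fun
      (RightComoduleAlgebra.coassoc (K := K) (H := H) (A := A)) c
    simp only [LinearMap.comp_apply] at hco
    have hco' : (RightComoduleAlgebra.coact (K := K) (H := H)).toLinearMap.rTensor H
        (RightComoduleAlgebra.coact (K := K) (H := H) c) =
        (TensorProduct.assoc K A H H).symm ((Coalgebra.comul (R := K) (A := H)).lTensor A
          (RightComoduleAlgebra.coact (K := K) (H := H) c)) := by
      rw [LinearEquiv.eq_symm_apply]; exact hco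
    have hR : smashMul K H A C (a ⊗ₜ x) (smashMul K H A C (b ⊗ₜ y) (c ⊗ₜ z)) =
        smashAux K H a x y z (RightComoduleAlgebra.coact (K := K) (H := H) b)
          ((RightComoduleAlgebra.coact (K := K) (H := H)).toLinearMap.rTensor H
          (RightComoduleAlgebra.coact (K := K) (H := H) c)) := by
      rw [smashMul_tmul K H b c y z]
      generalize RightComoduleAlgebra.coact (K := K) (H := H) c = v
      induction v with
      | zero => simp
      | add s t hs ht => simp only [map_add, hs, ht]
      | tmul c k =>
        simp only [TensorProduct.map_tmul, smashMul_tmul, LinearMap.mulLeft_apply, map_mul,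
          LinearMap.rTensor_tmul, smashAux_tmul, AlgHom.toLinearMap_apply]
    rw [hR, hco', smashMul_tmul]
    generalize RightComoduleAlgebra.coact (K := K) (H := H) b = t
    induction t with
    | zero => simp [smashAux_zero]
    | add s t hs ht => simp only [map_add, LinearMap.add_apply, smashAux_add, hs, ht]
    | tmul b h =>
      rw [TensorProduct.map_tmul, smashMul_tmul]
      generalize RightComoduleAlgebra.coact (K := K) (H := H) c = v
      induction v with
      | zero => simp
      | add s t hs ht => simp only [map_add, hs, ht]
      | tmul c k =>
        rw [TensorProduct.map_tmul, LinearMap.lTensor_tmul, twist_apply, twist_apply, mul_dualAct]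
        generalize Coalgebra.comul (R := K) k = w
        induction w with
        | zero => simp
        | add s t hs ht => simp only [map_add, TensorProduct.tmul_add, add_mul, hs, ht]
        | tmul k l =>
          simp [smashAux_tmul, twist_apply, dualAct_mul, mul_assoc]

end Smash

section SmashRing

variable (K H A C : Type u) [CommRing K] [Ring H] [HopfAlgebra K H]
  [Ring A] [Algebra K A] [RightComoduleAlgebra K H A]
  [AddCommGroup C] [Module K C] [Coalgebra K C] [Module H C] [IsScalarTower K H C]
  [LeftModuleCoalgebra K H C]

/-- The smash product `A # C*`: the module `A ⊗ C*` with the multiplication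
`(a # x)(b # y) = ∑ a b₀ # (x b₁) y` and the unit `1 # ε`. -/
def Smash (K H A C : Type u) [CommRing K] [Ring H] [HopfAlgebra K H]
    [Ring A] [Algebra K A] [RightComoduleAlgebra K H A]
    [AddCommGroup C] [Module K C] [Coalgebra K C] [Module H C] [IsScalarTower K H C]
    [LeftModuleCoalgebra K H C] : Type u :=
  A ⊗[K] ConvDual K C

instance : AddCommGroup (Smash K H A C) := inferInstanceAs (AddCommGroup (A ⊗[K] ConvDual K C))

/-- The identity map from `A ⊗ C*` to the smash product. -/
def Smash.ofTensor : A ⊗[K] ConvDual K C ≃+ Smash K H A C := AddEquiv.refl (A ⊗[K] ConvDual K C)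

variable {A C} in
/-- The element `a # x` of the smash product. -/
def Smash.mk (a : A) (x : ConvDual K C) : Smash K H A C := Smash.ofTensor K H A C (a ⊗ₜ[K] x)

instance : Ring (Smash K H A C) where
  __ := (inferInstance : AddCommGroup (Smash K H A C))
  mul u v := smashMul K H A C u v
  one := Smash.mk K H 1 1
  one_mul := smashMul_one_left K H A C
  mul_one := smashMul_one_right K H A C
  mul_assoc := smashMul_assoc K H A C
  left_distrib u v w := map_add (smashMul K H A C u) v w
  right_distrib u v w := LinearMap.map_add₂ (smashMul K H A C) u v w
  zero_mul u := LinearMap.map_zero₂ (smashMul K H A C) u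
  mul_zero u := map_zero (smashMul K H A C u)

variable {A C} in
theorem Smash.mk_mul_mk (a b : A) (x y : ConvDual K C) :
    Smash.mk K H a x * Smash.mk K H b y =
      Smash.ofTensor K H A C (TensorProduct.map (LinearMap.mulLeft K a) (twist K H C x y)
        (RightComoduleAlgebra.coact (K := K) (H := H) b)) := rfl

variable {A C} in
theorem Smash.induction_on {P : Smash K H A C → Prop} (u : Smash K H A C) (zero : P 0)
    (mk : ∀ a x, P (Smash.mk K H a x)) (add : ∀ u v, P u → P v → P (u + v)) : P u :=
  TensorProduct.induction_on (motive := fun t => P (Smash.ofTensor K H A C t)) u zero mk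
    (fun _ _ hs ht => add _ _ hs ht)

/-- The ring homomorphism `C* → A # C*`, `x ↦ 1 # x`. -/
def Smash.ofDual : ConvDual K C →+* Smash K H A C where
  toFun x := Smash.mk K H 1 x
  map_zero' := TensorProduct.tmul_zero _ _
  map_one' := rfl
  map_add' x y := TensorProduct.tmul_add _ _ _
  map_mul' x y := by
    rw [Smash.mk_mul_mk, map_one (RightComoduleAlgebra.coact (K := K) (H := H) (A := A)),
      Algebra.TensorProduct.one_def, TensorProduct.map_tmul, twist_apply, dualAct_one,
      LinearMap.mulLeft_apply, one_mul]
    rfl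

/-- `A # C*` as a left `C*`-module through `C* → A # C*`. -/
instance : Module (ConvDual K C) (Smash K H A C) := Module.compHom _ (Smash.ofDual K H A C)

variable {A C} in
theorem dual_smul_smash (x : ConvDual K C) (u : Smash K H A C) :
    x • u = Smash.mk K H 1 x * u := rfl

/-- The `K`-module structure of `A # C*`. -/
instance : Module K (Smash K H A C) := inferInstanceAs (Module K (A ⊗[K] ConvDual K C))

variable {A C} in
theorem algebraMap_smul_smash (k : K) (u : Smash K H A C) :
    algebraMap K (ConvDual K C) k • u = k • u := by
  have h1 : Smash.mk K H (1 : A) (algebraMap K (ConvDual K C) k) =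
      k • (1 : Smash K H A C) := by
    rw [Algebra.algebraMap_eq_smul_one]
    exact TensorProduct.tmul_smul k (1 : A) (1 : ConvDual K C)
  have h2 : (k • (1 : Smash K H A C)) * u = k • (1 * u) :=
    LinearMap.map_smul₂ (smashMul K H A C) k _ u
  rw [dual_smul_smash, h1, h2, one_mul]

variable {A C} in
theorem Smash.mul_smul_comm (k : K) (v u : Smash K H A C) : v * (k • u) = k • (v * u) :=
  LinearMap.map_smul (smashMul K H A C v) k u

variable {A C} in
theorem IsRational.smash_mul (v : Smash K H A C) {u : Smash K H A C} (hu : IsRational K C u) :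
    IsRational K C (v * u) := by
  induction v using Smash.induction_on with
  | zero => rw [zero_mul]; exact IsRational.zero
  | add s t hs ht => rw [add_mul]; exact IsRational.add hs ht
  | mk a x =>
    have key : ∀ t : A ⊗[K] H, HasParams (fun z : ConvDual K C =>
        Smash.ofTensor K H A C (TensorProduct.map (LinearMap.mulLeft K 1)
          (twist K H C z x) t) * u) := by
      intro t
      induction t with
      | zero =>
        simp only [map_zero, zero_mul]
        exact HasParams.zero
      | add s t hs ht =>
        simp only [map_add, add_mul]
        exact HasParams.add hs ht
      | tmul b h =>
        obtain ⟨n, c, m', hm⟩ := IsRational.smul x hu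
        refine ⟨n, fun i => h • c i, fun i => Smash.mk K H b 1 * m' i, fun z => ?_⟩
        have h1 : Smash.ofTensor K H A C (TensorProduct.map (LinearMap.mulLeft K 1)
            (twist K H C z x) (b ⊗ₜ[K] h)) =
            Smash.mk K H b 1 * Smash.mk K H 1 (dualAct K H C z h * x) := by
          rw [Smash.mk_mul_mk, map_one (RightComoduleAlgebra.coact (K := K) (H := H) (A := A)),
            Algebra.TensorProduct.one_def, TensorProduct.map_tmul, TensorProduct.map_tmul,
            twist_apply, twist_apply, dualAct_one, one_mul, LinearMap.mulLeft_apply,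
            LinearMap.mulLeft_apply, one_mul, mul_one]
        change Smash.ofTensor K H A C (TensorProduct.map (LinearMap.mulLeft K 1)
            (twist K H C z x) (b ⊗ₜ[K] h)) * u = _
        rw [h1, mul_assoc, ← dual_smul_smash, mul_smul, hm, Finset.mul_sum]
        refine Finset.sum_congr rfl fun i _ => ?_
        rw [algebraMap_smul_smash, algebraMap_smul_smash, Smash.mul_smul_comm]
        rfl
    obtain ⟨n, c, m', hm⟩ := key (RightComoduleAlgebra.coact (K := K) (H := H) a)
    refine ⟨n, c, m', fun z => ?_⟩
    rw [← hm z, dual_smul_smash, ← mul_assoc, Smash.mk_mul_mk]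

theorem IsRational.smash_mul_right {u : Smash K H A C} (hu : IsRational K C u)
    (v : Smash K H A C) : IsRational K C (u * v) := by
  obtain ⟨n, c, m', hm⟩ := hu
  refine ⟨n, c, fun i => m' i * v, fun z => ?_⟩
  rw [dual_smul_smash, ← mul_assoc, ← dual_smul_smash, hm, Finset.sum_mul]
  refine Finset.sum_congr rfl fun i _ => ?_
  rw [dual_smul_smash, dual_smul_smash, mul_assoc]

/-- The ideal `𝔞` of rational elements of `A # C*`, as a left ideal. -/
def ratIdeal : Submodule (Smash K H A C) (Smash K H A C) where
  carrier := {u | IsRational K C u}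
  zero_mem' := IsRational.zero
  add_mem' := IsRational.add
  smul_mem' v _ hu := IsRational.smash_mul K H v hu

/-- Right multiplication by `b` on `𝔞`. -/
def ratIdealMulRight (b : Smash K H A C) :
    ratIdeal K H A C →ₗ[Smash K H A C] ratIdeal K H A C where
  toFun u := ⟨u.1 * b, IsRational.smash_mul_right K H A C u.2 b⟩
  map_add' u v := Subtype.ext (add_mul u.1 v.1 b)
  map_smul' w u := Subtype.ext (mul_assoc w u.1 b)

variable {C} in
/-- For `r ∈ Rat_C(C*)`, the element `1 # r` of `𝔞`. -/
def ratIdealOfRat (r : rat K C (ConvDual K C)) : ratIdeal K H A C :=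
  ⟨Smash.mk K H 1 r.1, by
    obtain ⟨n, c, m', hm⟩ := r.2
    refine ⟨n, c, fun i => Smash.mk K H 1 (m' i), fun z => ?_⟩
    have h : ∀ y z : ConvDual K C, z • Smash.mk K H (1 : A) y = Smash.mk K H 1 (z • y) :=
      fun y z => ((Smash.ofDual K H A C).map_mul z y).symm
    rw [h, hm]
    simp only [h]
    exact map_sum (Smash.ofDual K H A C) _ _⟩

end SmashRing

section DKModules

/-- A Doi-Koppinen module: a left `A`-module with a right `C`-comodule structure such that
`ρ(a m) = ∑ a₀ m₀ ⊗ a₁ m₁`. -/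
structure DKMod (K H A C : Type u) [CommRing K] [Ring H] [HopfAlgebra K H]
    [Ring A] [Algebra K A] [RightComoduleAlgebra K H A]
    [AddCommGroup C] [Module K C] [Coalgebra K C] [Module H C] [IsScalarTower K H C]
    [LeftModuleCoalgebra K H C] where
  carrier : Type u
  [addCommGroup : AddCommGroup carrier]
  [moduleK : Module K carrier]
  [moduleA : Module A carrier]
  [isScalarTower : IsScalarTower K A carrier]
  coact : carrier →ₗ[K] carrier ⊗[K] C
  coassoc : (TensorProduct.assoc K carrier C C).toLinearMap ∘ₗ coact.rTensor C ∘ₗ coact =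
    (Coalgebra.comul (R := K) (A := C)).lTensor carrier ∘ₗ coact
  counit_coact : (TensorProduct.rid K carrier).toLinearMap ∘ₗ
    (Coalgebra.counit (R := K) (A := C)).lTensor carrier ∘ₗ coact = LinearMap.id
  coact_smul : ∀ (a : A) (m : carrier), coact (a • m) =
    diagAct K A H carrier C (RightComoduleAlgebra.coact a) (coact m)

variable {K H A C : Type u} [CommRing K] [Ring H] [HopfAlgebra K H]
  [Ring A] [Algebra K A] [RightComoduleAlgebra K H A]
  [AddCommGroup C] [Module K C] [Coalgebra K C] [Module H C] [IsScalarTower K H C]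
  [LeftModuleCoalgebra K H C]

namespace DKMod

instance : CoeSort (DKMod K H A C) (Type u) := ⟨DKMod.carrier⟩

instance (M : DKMod K H A C) : AddCommGroup M := M.addCommGroup
instance (M : DKMod K H A C) : Module K M := M.moduleK
instance (M : DKMod K H A C) : Module A M := M.moduleA
instance (M : DKMod K H A C) : IsScalarTower K A M := M.isScalarTower

/-- A morphism of Doi-Koppinen modules: a left `A`-linear and right `C`-colinear map. -/
@[ext]
structure Hom (M N : DKMod K H A C) where
  toLin : M →ₗ[A] N
  colinear : N.coact ∘ₗ toLin.restrictScalars K =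
    (toLin.restrictScalars K).rTensor C ∘ₗ M.coact

instance : Category (DKMod K H A C) where
  Hom M N := Hom M N
  id M := ⟨LinearMap.id, by ext m; simp⟩
  comp f g := ⟨g.toLin ∘ₗ f.toLin, by
    have hf := f.colinear
    have hg := g.colinear
    ext m
    have h1 := LinearMap.congr_fun hf m
    have h2 := LinearMap.congr_fun hg (f.toLin m)
    simp only [LinearMap.comp_apply, LinearMap.coe_restrictScalars] at h1 h2 ⊢
    rw [h2, h1, ← LinearMap.comp_apply, ← LinearMap.rTensor_comp]
    rfl⟩

/-- The action of `C*` on a right `C`-comodule: `x m = ∑ x(m₁) m₀`. -/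
def dualEnd (M : DKMod K H A C) : ConvDual K C →ₗ[K] Module.End K M where
  toFun x := (TensorProduct.rid K M).toLinearMap ∘ₗ x.ofConv.lTensor M ∘ₗ M.coact
  map_add' x y := by ext m; simp [LinearMap.lTensor_add]
  map_smul' k x := by ext m; simp [LinearMap.lTensor_smul]

theorem dualEnd_apply (M : DKMod K H A C) (x : ConvDual K C) (m : M) :
    M.dualEnd x m = TensorProduct.rid K M (x.ofConv.lTensor M (M.coact m)) := rfl

/-- The action of `A # C*` on a Doi-Koppinen module: `(a # x) m = a (x m) = ∑ x(m₁) a m₀`. -/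
def smashEnd (M : DKMod K H A C) : A ⊗[K] ConvDual K C →ₗ[K] Module.End K M :=
  LinearMap.mul' K (Module.End K M) ∘ₗ
    TensorProduct.map (Algebra.lsmul K K M : A →ₐ[K] Module.End K M).toLinearMap M.dualEnd

theorem smashEnd_tmul (M : DKMod K H A C) (a : A) (x : ConvDual K C) (m : M) :
    M.smashEnd (a ⊗ₜ x) m = a • M.dualEnd x m := rfl

theorem dualEnd_one (M : DKMod K H A C) : M.dualEnd 1 = 1 :=
  M.counit_coact

theorem dualEnd_mul (M : DKMod K H A C) (x y : ConvDual K C) :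
    M.dualEnd (x * y) = M.dualEnd x * M.dualEnd y := by
  ext m
  have h := LinearMap.congr_fun M.coassoc m
  simp only [LinearMap.comp_apply] at h
  have h' : M.coact.rTensor C (M.coact m) = (TensorProduct.assoc K M C C).symm
      ((Coalgebra.comul (R := K) (A := C)).lTensor M (M.coact m)) := by
    rw [LinearEquiv.eq_symm_apply]; exact h
  let Ψ : (M ⊗[K] C) ⊗[K] C →ₗ[K] M := (TensorProduct.rid K M).toLinearMap ∘ₗ
    x.ofConv.lTensor M ∘ₗ (TensorProduct.rid K (M ⊗[K] C)).toLinearMap ∘ₗ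
    y.ofConv.lTensor (M ⊗[K] C)
  have hR : (M.dualEnd x * M.dualEnd y) m = Ψ (M.coact.rTensor C (M.coact m)) := by
    rw [Module.End.mul_apply, dualEnd_apply M y m]
    generalize M.coact m = t
    induction t with
    | zero => simp
    | add s t hs ht => simp only [map_add, hs, ht]
    | tmul m c => simp [Ψ, dualEnd_apply]
  rw [hR, h', dualEnd_apply]
  generalize M.coact m = t
  induction t with
  | zero => simp
  | add s t hs ht => simp only [map_add, hs, ht]
  | tmul m c =>
    simp only [LinearMap.lTensor_tmul, TensorProduct.rid_tmul]
    change LinearMap.mul' K K (TensorProduct.map x.ofConv y.ofConv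
      (Coalgebra.comul (R := K) c)) • m = _
    generalize Coalgebra.comul (R := K) c = w
    induction w with
    | zero => simp
    | add s t hs ht => simp only [map_add, add_smul, TensorProduct.tmul_add, hs, ht]
    | tmul c d => simp [Ψ, smul_smul, mul_comm]

/-- `x (b m) = ∑ b₀ ((x b₁) m)`. -/
theorem dualEnd_smul (M : DKMod K H A C) (x : ConvDual K C) (b : A) (m : M) :
    M.dualEnd x (b • m) = M.smashEnd (TensorProduct.map LinearMap.id (dualAct K H C x)
      (RightComoduleAlgebra.coact (K := K) (H := H) b)) m := by
  rw [dualEnd_apply, M.coact_smul]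
  generalize RightComoduleAlgebra.coact (K := K) (H := H) b = t
  induction t with
  | zero => simp
  | add s t hs ht => simp only [map_add, LinearMap.add_apply, hs, ht]
  | tmul b h =>
    rw [TensorProduct.map_tmul, smashEnd_tmul, dualEnd_apply]
    generalize M.coact m = w
    induction w with
    | zero => simp
    | add s t hs ht => simp only [map_add, smul_add, hs, ht]
    | tmul m c =>
      simp only [diagAct_tmul, LinearMap.lTensor_tmul, TensorProduct.rid_tmul, LinearMap.id_apply]
      exact (smul_comm b (x (h • c)) m).symm

theorem smashEnd_mul (M : DKMod K H A C) (u v : A ⊗[K] ConvDual K C) :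
    M.smashEnd (smashMul K H A C u v) = M.smashEnd u * M.smashEnd v := by
  induction u with
  | zero => simp
  | add s t hs ht => simp only [map_add, LinearMap.add_apply, add_mul, hs, ht]
  | tmul a x =>
  induction v with
  | zero => simp
  | add s t hs ht => simp only [map_add, mul_add, hs, ht]
  | tmul b y =>
    ext m
    rw [Module.End.mul_apply, smashEnd_tmul, smashEnd_tmul, dualEnd_smul, smashMul_tmul]
    generalize RightComoduleAlgebra.coact (K := K) (H := H) b = t
    induction t with
    | zero => simp
    | add s t hs ht => simp only [map_add, LinearMap.add_apply, smul_add, hs, ht]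
    | tmul b h =>
      simp [smashEnd_tmul, twist_apply, dualEnd_mul, mul_smul]

/-- A Doi-Koppinen module as a left `C*`-module, `x m = ∑ x(m₁) m₀`. -/
instance (M : DKMod K H A C) : Module (ConvDual K C) M where
  smul x m := M.dualEnd x m
  one_smul m := LinearMap.congr_fun M.dualEnd_one m
  mul_smul x y m := LinearMap.congr_fun (M.dualEnd_mul x y) m
  smul_zero x := map_zero (M.dualEnd x)
  smul_add x := map_add (M.dualEnd x)
  add_smul x y m := LinearMap.congr_fun (map_add M.dualEnd x y) m
  zero_smul m := LinearMap.congr_fun (map_zero M.dualEnd) m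

/-- A Doi-Koppinen module as a left `A # C*`-module, `(a # x) m = a (x m)`. -/
instance (M : DKMod K H A C) : Module (Smash K H A C) M where
  smul u m := M.smashEnd u m
  one_smul m := (one_smul A (M.dualEnd 1 m)).trans (LinearMap.congr_fun M.dualEnd_one m)
  mul_smul u v m := LinearMap.congr_fun (M.smashEnd_mul u v) m
  smul_zero u := map_zero (M.smashEnd u)
  smul_add u := map_add (M.smashEnd u)
  add_smul u v m := LinearMap.congr_fun (map_add M.smashEnd u v) m
  zero_smul m := LinearMap.congr_fun (map_zero M.smashEnd) m

theorem mk_smul (M : DKMod K H A C) (a : A) (x : ConvDual K C) (m : M) :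
    Smash.mk K H a x • m = a • x • m := rfl

theorem Hom.map_dual_smul {M N : DKMod K H A C} (f : Hom M N) (x : ConvDual K C) (m : M) :
    f.toLin (x • m) = x • f.toLin m := by
  have h := LinearMap.congr_fun f.colinear m
  simp only [LinearMap.comp_apply, LinearMap.coe_restrictScalars] at h
  change f.toLin (TensorProduct.rid K M (x.ofConv.lTensor M (M.coact m))) =
    TensorProduct.rid K N (x.ofConv.lTensor N (N.coact (f.toLin m)))
  rw [h]
  generalize M.coact m = t
  induction t with
  | zero => simp
  | add s t hs ht => simp only [map_add, hs, ht]
  | tmul m c =>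
    simp only [LinearMap.lTensor_tmul, TensorProduct.rid_tmul, LinearMap.rTensor_tmul]
    exact (f.toLin.restrictScalars K).map_smul _ _

theorem Hom.map_smash_smul {M N : DKMod K H A C} (f : Hom M N) (u : Smash K H A C) (m : M) :
    f.toLin (u • m) = u • f.toLin m := by
  change f.toLin (M.smashEnd u m) = N.smashEnd u (f.toLin m)
  induction u using TensorProduct.induction_on with
  | zero => simp
  | add s t hs ht => simp only [map_add, LinearMap.add_apply, hs, ht]
  | tmul a x =>
    rw [smashEnd_tmul, smashEnd_tmul, map_smul]
    exact congrArg (a • ·) (f.map_dual_smul x m)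

/-- The left `A # C*`-module attached to a Doi-Koppinen module. -/
def toSmash (M : DKMod K H A C) : ModuleCat.{u} (Smash K H A C) :=
  ModuleCat.of (Smash K H A C) M

/-- The underlying left `A`-module of a Doi-Koppinen module. -/
def toA (M : DKMod K H A C) : ModuleCat.{u} A := ModuleCat.of A M

end DKMod

end DKModules

section Hull

/-- `j : X ⟶ E` is an injective hull (injective envelope): `E` is injective and `j` is an
essential monomorphism. -/
structure IsInjectiveHull {D : Type*} [Category D] {X E : D} (j : X ⟶ E) : Prop where
  mono : Mono j
  injective : Injective E
  essential : ∀ {Z : D} (g : E ⟶ Z), Mono (j ≫ g) → Mono g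

end Hull

namespace DKMod

variable {K H A C : Type u} [CommRing K] [Ring H] [HopfAlgebra K H]
  [Ring A] [Algebra K A] [RightComoduleAlgebra K H A]
  [AddCommGroup C] [Module K C] [Coalgebra K C] [Module H C] [IsScalarTower K H C]
  [LeftModuleCoalgebra K H C]

/-- `Hom(𝔞, E)`, the left `A # C*`-linear maps, as a left `A # C*`-module:
`(b f)(u) = f(u b)`. -/
abbrev idealHomModule (E : DKMod K H A C) :
    Module (Smash K H A C) (ratIdeal K H A C →ₗ[Smash K H A C] E) where
  smul b f := f ∘ₗ ratIdealMulRight K H A C b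
  one_smul f := LinearMap.ext fun u => congrArg f (Subtype.ext (mul_one u.1))
  mul_smul b c f := LinearMap.ext fun u => congrArg f (Subtype.ext (mul_assoc u.1 b c).symm)
  smul_zero _ := rfl
  smul_add _ _ _ := rfl
  add_smul b c f := LinearMap.ext fun u =>
    (congrArg f (Subtype.ext (mul_add u.1 b c))).trans (map_add f _ _)
  zero_smul f := LinearMap.ext fun u =>
    (congrArg f (Subtype.ext (mul_zero u.1))).trans (map_zero f)

/-- The left `C*`-linear maps `Rat_C(C*) → E`. -/
abbrev RatHom (E : DKMod K H A C) : Type u :=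
  rat K C (ConvDual K C) →ₗ[ConvDual K C] E

/-- The map `Hom(𝔞, E) → Hom(Rat_C(C*), E)`, `f ↦ (r ↦ f(1 # r))`. -/
def hatMap (E : DKMod K H A C) :
    (ratIdeal K H A C →ₗ[Smash K H A C] E) →+ E.RatHom where
  toFun f :=
    { toFun r := f (ratIdealOfRat K H A r)
      map_add' r s := by
        rw [← map_add]
        exact congrArg f (Subtype.ext ((Smash.ofDual K H A C).map_add r.1 s.1))
      map_smul' x r := by
        have h : ratIdealOfRat K H A (x • r) =
            Smash.mk K H (1 : A) x • ratIdealOfRat K H A r :=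
          Subtype.ext (by
            change Smash.ofDual K H A C (x * r.1) = Smash.ofDual K H A C x *
              Smash.ofDual K H A C r.1
            exact (Smash.ofDual K H A C).map_mul x r.1)
        rw [h, map_smul, mk_smul, one_smul]
        rfl }
  map_zero' := rfl
  map_add' _ _ := rfl

/-- The left `A # C*`-module structure on `Hom(Rat_C(C*), E)` transferred along the bijection
`hatMap E` from that of `Hom(𝔞, E)`. -/
abbrev ratHomModule (E : DKMod K H A C) (h : Function.Bijective E.hatMap) :
    Module (Smash K H A C) E.RatHom :=
  letI := E.idealHomModule
  (AddEquiv.ofBijective E.hatMap h).symm.module (Smash K H A C)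

/-- `Hom(Rat_C(C*), E)` as an object of the category of left `A # C*`-modules. -/
def ratHom (E : DKMod K H A C) (h : Function.Bijective E.hatMap) :
    ModuleCat.{u} (Smash K H A C) :=
  letI := E.ratHomModule h
  ModuleCat.of (Smash K H A C) E.RatHom

/-- The map `ζ : M → Hom(Rat_C(C*), E)`, `ζ(m)(r) = r j(m)`, for `j : M ⟶ E`. -/
def zeta {M E : DKMod K H A C} (j : M ⟶ E) (h : Function.Bijective E.hatMap) :
    M.toSmash ⟶ E.ratHom h :=
  letI := E.ratHomModule h
  ModuleCat.ofHom (X := M) (Y := E.RatHom)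
    { toFun m :=
        { toFun r := (r : ConvDual K C) • Hom.toLin j m
          map_add' r s := add_smul _ _ _
          map_smul' x r := mul_smul _ _ _ }
      map_add' m n := LinearMap.ext fun r => by
        change (r : ConvDual K C) • Hom.toLin j (m + n) = _
        rw [map_add, smul_add]; rfl
      map_smul' b m := by
        let := E.idealHomModule
        let f : ratIdeal K H A C →ₗ[Smash K H A C] E :=
          { toFun u := u.1 • Hom.toLin j m
            map_add' u v := add_smul _ _ _
            map_smul' w u := mul_smul _ _ _ }
        have h1 : ∀ (g : ratIdeal K H A C →ₗ[Smash K H A C] E),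
            b • E.hatMap g = E.hatMap (b • g) := by
          intro g
          change (AddEquiv.ofBijective E.hatMap h)
            (b • (AddEquiv.ofBijective E.hatMap h).symm (E.hatMap g)) = _
          exact congrArg (fun g' => E.hatMap (b • g'))
            ((AddEquiv.ofBijective E.hatMap h).symm_apply_apply g)
        have h2 : ∀ m' : M, ∀ r : rat K C (ConvDual K C),
            (r : ConvDual K C) • Hom.toLin j m' =
              (Smash.mk K H (1 : A) r.1) • Hom.toLin j m' := by
          intro m' r; rw [mk_smul, one_smul]
        refine Eq.trans ?_ ((h1 f).symm.trans ?_)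
        · ext r
          change (r : ConvDual K C) • Hom.toLin j (b • m) = ((Smash.mk K H 1 r.1) * b) • _
          rw [h2, Hom.map_smash_smul, mul_smul]
        · simp only [RingHom.id_apply]
          congr 1
          ext r
          exact (h2 m r).symm }

end DKMod

end DoiKoppinen

end

/-! The category of Doi-Koppinen modules is a category of modules over `A # C*` in disguise.
Exactness of `Rat_C` forces every rational element to be fixed by an element of `Rat_C(C*)`
(`exists_rat_smul_eq`), so the ideal `𝔞` and all Doi-Koppinen modules are `s`-unital over `𝔞`.
Conversely, local projectivity of `C` makes elements of `X ⊗ C` visible to `C*`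
(`IsLocallyProjective.tensor_ext`), so an `s`-unital `A # C*`-module carries a unique compatible
coaction (`exists_dkMod`). Monomorphisms become injective maps, and injectivity becomes injectivity
among `s`-unital modules (`DKMod.injective_iff`).

What remains is ring theory for an `s`-unital two-sided ideal. The `s`-unital part of an injective
hull over `A # C*` is a hull among Doi-Koppinen modules. In the other direction, `Hom(𝔞, E)` is
injective over the whole ring whenever `E` is injective among `s`-unital modules
(`exists_extension_hom_ideal`), since maps into it amount to maps from the `s`-unital part into `E`.
Flatness of `A` identifies `𝔞` with `A ⊗ Rat_C(C*)`, whence `Hom(𝔞, E) ≅ Hom(Rat_C(C*), E)`.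
Essentiality of `ζ` comes from `(1 # r) φ = ζ_E(φ(r))`: multiplying by `𝔞` moves every `φ` into the
image of `E`. This gives (a), and (b) follows formally.

For (c), finite support supplies an element of `Rat_C(C*)` acting as the identity on `M`, which
makes `ζ` bijective and hence `M` injective over `A # C*`. A bijective antipode gives `A # C* ≅ C* ⊗
A` as right `A`-modules, which is flat when `C*` is, and restriction along a ring map that is flat
on the right preserves injectivity. -/

noncomputable section

namespace DoiKoppinen

/-! ### Injective hulls of modules over a ring -/

section InjectiveHull

variable {R : Type u} [Ring R] {Q : Type u} [AddCommGroup Q] [Module R Q]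

/-- Among the submodules of `Q` in which `P` is essential there is a maximal one. -/
theorem exists_maximal_essential (P : Submodule R Q) :
    ∃ N : Submodule R Q, Maximal (fun N => P ≤ N ∧ ∀ X ≤ N, X ⊓ P = ⊥ → X = ⊥) N := by
  have hP : P ≤ P ∧ ∀ X ≤ P, X ⊓ P = ⊥ → X = ⊥ :=
    ⟨le_rfl, fun X hX h => by rwa [inf_eq_left.2 hX] at h⟩
  obtain ⟨N, -, hN⟩ := zorn_le_nonempty₀
    {N : Submodule R Q | P ≤ N ∧ ∀ X ≤ N, X ⊓ P = ⊥ → X = ⊥} (by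
    intro c hc hchain y hy
    refine ⟨sSup c, ⟨(hc hy).1.trans (le_sSup hy), fun X hX h => ?_⟩, fun z hz => le_sSup hz⟩
    rw [eq_bot_iff]
    intro x hx
    obtain ⟨N, hN, hxN⟩ := (Submodule.mem_sSup_of_directed ⟨y, hy⟩ hchain.directedOn).1 (hX hx)
    -- Essentiality is tested on the cyclic submodule of `x`, which already lies in one member of
    -- the chain.
    have hspan : R ∙ x ≤ X := (Submodule.span_singleton_le_iff_mem x X).2 hx
    have := (hc hN).2 (R ∙ x) ((Submodule.span_singleton_le_iff_mem x N).2 hxN)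
      (eq_bot_iff.2 ((inf_le_inf_right P hspan).trans h.le))
    rw [← this]
    exact Submodule.mem_span_singleton_self x) P hP
  exact ⟨N, hN⟩

/-- Among the submodules of `Q` that meet `N` trivially there is a maximal one. -/
theorem exists_maximal_inf_eq_bot (N : Submodule R Q) :
    ∃ L : Submodule R Q, Maximal (fun L => L ⊓ N = ⊥) L := by
  obtain ⟨L, -, hL⟩ := zorn_le_nonempty₀ {L : Submodule R Q | L ⊓ N = ⊥} (by
    intro c hc hchain y hy
    refine ⟨sSup c, ?_, fun z hz => le_sSup hz⟩
    change sSup c ⊓ N = ⊥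
    rw [eq_bot_iff]
    rintro x ⟨hx, hxN⟩
    obtain ⟨L, hL, hxL⟩ := (Submodule.mem_sSup_of_directed ⟨y, hy⟩ hchain.directedOn).1 hx
    exact (hc hL).le ⟨hxL, hxN⟩) ⊥ (show ⊥ ⊓ N = ⊥ from bot_inf_eq N)
  exact ⟨L, hL⟩

/-- A submodule of an injective module that is maximal among the essential extensions of a
submodule `P` is a retract. -/
theorem exists_retraction_of_maximal_essential [Module.Injective R Q] {P N : Submodule R Q}
    (hN : Maximal (fun N => P ≤ N ∧ ∀ X ≤ N, X ⊓ P = ⊥ → X = ⊥) N) :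
    ∃ r : Q →ₗ[R] N, ∀ n : N, r n = n := by
  -- `L` is a maximal complement of `N`, so `N` embeds in `Q / L` and injectivity of `Q` gives `φ :
  -- Q / L → Q` fixing `N`. It suffices that `φ` has no larger image than `N`.
  obtain ⟨L, hL⟩ := exists_maximal_inf_eq_bot N
  have hq : Function.Injective (L.mkQ ∘ₗ N.subtype) := by
    rw [← LinearMap.ker_eq_bot, eq_bot_iff]
    intro n hn
    have : (n : Q) ∈ L ⊓ N := ⟨by simpa using hn, n.2⟩
    rw [hL.prop] at this
    exact Subtype.ext this
  obtain ⟨φ, hφ⟩ := Module.Injective.out (L.mkQ ∘ₗ N.subtype) hq N.subtype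
  have hφ' : ∀ n ∈ N, φ (L.mkQ n) = n := fun n hn => hφ ⟨n, hn⟩
  -- If `X` meets `P` trivially, it meets `N` trivially because `P` is essential in `N`. As `φ ∘
  -- mkQ` fixes `N`, the preimage of `X` then meets `N` trivially too, and it contains `L`, so
  -- maximality of `L` applies.
  have hmeet : ∀ X : Submodule R Q, X ⊓ P = ⊥ → X.comap (φ ∘ₗ L.mkQ) = L := by
    intro X hX
    have hLX : L ≤ X.comap (φ ∘ₗ L.mkQ) := fun l hl => by
      have : L.mkQ l = 0 := (Submodule.Quotient.mk_eq_zero L).2 hl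
      simp [LinearMap.comp_apply, this]
    have hXN : X ⊓ N = ⊥ := hN.prop.2 _ inf_le_right (by
      rw [eq_bot_iff, ← hX]
      exact fun x hx => ⟨hx.1.1, hx.2⟩)
    refine (hL.eq_of_le ?_ hLX).symm
    rw [eq_bot_iff, ← hXN]
    rintro x ⟨hx, hxN⟩
    refine ⟨?_, hxN⟩
    have : φ (L.mkQ x) ∈ X := hx
    rwa [hφ' x hxN] at this
  -- By `hmeet`, a submodule of the image of `φ` that avoids `P` is the image of `L / L`, hence
  -- zero. So `P` is essential in the image, and maximality of `N` applies.
  have hrange : N = LinearMap.range φ := by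
    refine hN.eq_of_le ⟨fun p hp => ⟨L.mkQ p, hφ' p (hN.prop.1 hp)⟩, fun X hX h => ?_⟩
      fun n hn => ⟨L.mkQ n, hφ' n hn⟩
    rw [eq_bot_iff]
    intro x hx
    obtain ⟨y, rfl⟩ := hX hx
    obtain ⟨z, rfl⟩ := L.mkQ_surjective y
    have hz : z ∈ X.comap (φ ∘ₗ L.mkQ) := hx
    rw [hmeet X h] at hz
    have : L.mkQ z = 0 := (Submodule.Quotient.mk_eq_zero L).2 hz
    simp [this]
  refine ⟨(φ ∘ₗ L.mkQ).codRestrict N fun x => ?_, fun n => Subtype.ext (hφ n)⟩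
  rw [hrange]
  exact ⟨_, rfl⟩

/-- Every module embeds as an essential submodule into an injective module. -/
theorem exists_module_injectiveHull (R : Type u) [Ring R] (M : Type u) [AddCommGroup M]
    [Module R M] :
    ∃ (E : Type u) (_ : AddCommGroup E) (_ : Module R E) (j : M →ₗ[R] E),
      Function.Injective j ∧ Module.Injective R E ∧
        ∀ X : Submodule R E, X ⊓ LinearMap.range j = ⊥ → X = ⊥ := by
  obtain ⟨⟨Q, hQ, i, hi⟩⟩ := EnoughInjectives.presentation (ModuleCat.of R M)
  have hi : Function.Injective i.hom := (ModuleCat.mono_iff_injective i).1 hi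
  have hQ : Module.Injective R Q := (Module.injective_iff_injective_object R Q).2 hQ
  obtain ⟨N, hN⟩ := exists_maximal_essential (LinearMap.range i.hom)
  obtain ⟨r, hr⟩ := exists_retraction_of_maximal_essential hN
  have hmem : ∀ m, i.hom m ∈ N := fun m => hN.prop.1 ⟨m, rfl⟩
  refine ⟨N, inferInstance, inferInstance, i.hom.codRestrict N hmem, fun a b h => hi ?_, ⟨?_⟩, ?_⟩
  · exact congrArg Subtype.val h
  · intro X Y _ _ _ _ f hf g
    obtain ⟨h, hh⟩ := hQ.out f hf (N.subtype ∘ₗ g)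
    exact ⟨r ∘ₗ h, fun x => by rw [LinearMap.comp_apply, hh]; exact hr (g x)⟩
  · intro X hX
    have h := hN.prop.2 (X.map N.subtype) (Submodule.map_subtype_le N X) (by
      rw [eq_bot_iff]
      rintro _ ⟨⟨x, hx, rfl⟩, m, hm⟩
      have : x ∈ X ⊓ LinearMap.range (i.hom.codRestrict N hmem) := ⟨hx, m, Subtype.ext hm⟩
      rw [hX] at this
      rw [(Submodule.mem_bot R).1 this]
      simp)
    exact Submodule.map_injective_of_injective N.injective_subtype
      (h.trans (Submodule.map_bot _).symm)

end InjectiveHull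

/-! ### Modules that are `s`-unital over an ideal -/

section SUnital

variable {R : Type u} [Ring R] (I : Ideal R)

/-- A module is `s`-unital over a left ideal `I` if each of its elements is fixed by an element
of `I`. -/
def IsSUnital (X : Type u) [AddCommGroup X] [Module R X] : Prop :=
  ∀ x : X, ∃ t ∈ I, t • x = x

/-- A module `E` is injective with respect to the `s`-unital modules. -/
def IsSUnitalInjective (E : Type u) [AddCommGroup E] [Module R E] : Prop :=
  ∀ (X Y : Type u) [AddCommGroup X] [AddCommGroup Y] [Module R X] [Module R Y],
    IsSUnital I X → IsSUnital I Y → ∀ i : X →ₗ[R] Y, Function.Injective i →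
      ∀ f : X →ₗ[R] E, ∃ g : Y →ₗ[R] E, ∀ x, g (i x) = f x

variable {I} {X : Type u} [AddCommGroup X] [Module R X]

theorem IsSUnital.of_surjective {Y : Type u} [AddCommGroup Y] [Module R Y] (f : X →ₗ[R] Y)
    (hf : Function.Surjective f) (hX : IsSUnital I X) : IsSUnital I Y := by
  intro y
  obtain ⟨x, rfl⟩ := hf y
  obtain ⟨t, ht, h⟩ := hX x
  exact ⟨t, ht, by rw [← map_smul, h]⟩

theorem IsSUnital.of_injective {Y : Type u} [AddCommGroup Y] [Module R Y] (f : X →ₗ[R] Y)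
    (hf : Function.Injective f) (hY : IsSUnital I Y) : IsSUnital I X := by
  intro x
  obtain ⟨t, ht, h⟩ := hY (f x)
  exact ⟨t, ht, hf (by rw [map_smul, h])⟩

theorem IsSUnital.eq_of_smul_eq (hX : IsSUnital I X) {x y : X}
    (h : ∀ t ∈ I, t • x = t • y) : x = y := by
  obtain ⟨t, ht, e⟩ := hX (x - y)
  rw [← sub_eq_zero, ← e, smul_sub, h t ht, sub_self]

/-- If the two-sided ideal `I` is `s`-unital, two elements fixed by elements of `I` have a common
unit in `I`. -/
theorem exists_common_unit (hI : IsSUnital I I) (hr : ∀ u ∈ I, ∀ b, u * b ∈ I) {x y : X}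
    (hx : ∃ t ∈ I, t • x = x) (hy : ∃ t ∈ I, t • y = y) :
    ∃ t ∈ I, t • x = x ∧ t • y = y := by
  obtain ⟨t, ht, hx⟩ := hx
  obtain ⟨s, hs, hy⟩ := hy
  -- The common unit `v = w + t - w t` is chosen so that `1 - v = (1 - w)(1 - t)`. The factor `1 -
  -- t` kills `x`, and `1 - w` kills `(1 - t) y = (s - t s) y`.
  obtain ⟨w, hw, h⟩ := hI ⟨s - t * s, I.sub_mem hs (hr t ht s)⟩
  have h : w * (s - t * s) = s - t * s := congrArg Subtype.val h
  refine ⟨w + t - w * t, I.sub_mem (I.add_mem hw ht) (hr w hw t), ?_, ?_⟩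
  · simp only [sub_smul, add_smul, mul_smul, hx]
    abel
  · have h' : w • (y - t • y) = y - t • y := by
      have := congrArg (· • y) h
      simpa only [mul_smul, sub_smul, hy] using this
    rw [smul_sub] at h'
    rw [sub_smul, add_smul, mul_smul, add_sub_right_comm, h', sub_add_cancel]

variable (X) in
/-- The largest `s`-unital submodule. -/
def sUnitalPart (hI : IsSUnital I I) (hr : ∀ u ∈ I, ∀ b, u * b ∈ I) : Submodule R X where
  carrier := {x | ∃ t ∈ I, t • x = x}
  zero_mem' := ⟨0, I.zero_mem, zero_smul R 0⟩
  add_mem' hx hy := by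
    obtain ⟨t, ht, hx, hy⟩ := exists_common_unit hI hr hx hy
    exact ⟨t, ht, by rw [smul_add, hx, hy]⟩
  smul_mem' b x := by
    rintro ⟨t, ht, hx⟩
    obtain ⟨w, hw, h⟩ := hI ⟨b * t, I.mul_mem_left b ht⟩
    have h : w * (b * t) = b * t := congrArg Subtype.val h
    refine ⟨w, hw, ?_⟩
    rw [← hx, smul_smul b, smul_smul w, h]

theorem isSUnital_sUnitalPart (hI : IsSUnital I I) (hr : ∀ u ∈ I, ∀ b, u * b ∈ I) :
    IsSUnital I (sUnitalPart X hI hr) := fun ⟨_, t, ht, h⟩ => ⟨t, ht, Subtype.ext h⟩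

theorem smul_mem_sUnitalPart (hI : IsSUnital I I) (hr : ∀ u ∈ I, ∀ b, u * b ∈ I) {u : R}
    (hu : u ∈ I) (x : X) : u • x ∈ sUnitalPart X hI hr := by
  obtain ⟨w, hw, h⟩ := hI ⟨u, hu⟩
  have h : w * u = u := congrArg Subtype.val h
  exact ⟨w, hw, by rw [smul_smul, h]⟩

/-- The `s`-unital part of an injective module is injective among the `s`-unital modules. -/
theorem isSUnitalInjective_sUnitalPart (hI : IsSUnital I I) (hr : ∀ u ∈ I, ∀ b, u * b ∈ I)
    [Module.Injective R X] : IsSUnitalInjective I (sUnitalPart X hI hr) := by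
  intro Y Z _ _ _ _ _ hZ i hi f
  obtain ⟨g, hg⟩ := Module.Injective.out i hi ((sUnitalPart X hI hr).subtype ∘ₗ f)
  refine ⟨g.codRestrict _ fun z => ?_, fun y => Subtype.ext (hg y)⟩
  obtain ⟨t, ht, h⟩ := hZ z
  exact ⟨t, ht, by rw [← map_smul, h]⟩

/-- For `E` injective among the `s`-unital modules, the module `Hom(I, E)`, with
`(b f)(u) = f(u b)`, has the extension property of injective modules. -/
theorem exists_extension_hom_ideal (hI : IsSUnital I I) (hr : ∀ u ∈ I, ∀ b, u * b ∈ I)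
    {E : Type u} [AddCommGroup E] [Module R E] (hE : IsSUnital I E)
    (hinj : IsSUnitalInjective I E)
    {Y : Type u} [AddCommGroup Y] [Module R Y] (i : X →ₗ[R] Y) (hi : Function.Injective i)
    (F : X →+ (I →ₗ[R] E)) (hF : ∀ b x (u : I), F (b • x) u = F x ⟨u * b, hr u u.2 b⟩) :
    ∃ G : Y →+ (I →ₗ[R] E), (∀ b y (u : I), G (b • y) u = G y ⟨u * b, hr u u.2 b⟩) ∧
      ∀ x, G (i x) = F x := by
  -- If `x = t x` with `t ∈ I`, then `F(x)(u) = F(t x)(u) = F(x)(u t) = u F(x)(t)`. So on the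
  -- `s`-unital part `F(x)` is multiplication onto the element `F(x)(t)`, which is unique because
  -- `E` is `s`-unital.
  have hex : ∀ x : sUnitalPart X hI hr, ∃ e : E, ∀ u : I, F x u = u.1 • e := by
    rintro ⟨x, t, ht, hx⟩
    refine ⟨F x ⟨t, ht⟩, fun u => ?_⟩
    change F x u = _
    conv_lhs => rw [← hx, hF]
    rw [← map_smul]
    rfl
  choose φ hφ using hex
  have huniq : ∀ {x : sUnitalPart X hI hr} {e : E}, (∀ u : I, F x u = u.1 • e) → φ x = e :=
    fun h => hE.eq_of_smul_eq fun t ht => by rw [← h ⟨t, ht⟩, hφ]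
  let f : sUnitalPart X hI hr →ₗ[R] E :=
    { toFun := φ
      map_add' := fun x y => huniq fun u => by
        rw [Submodule.coe_add, map_add, LinearMap.add_apply, hφ, hφ, smul_add]
      map_smul' := fun b x => huniq fun u => by
        rw [Submodule.coe_smul, hF, hφ, mul_smul]; rfl }
  let i' : sUnitalPart X hI hr →ₗ[R] sUnitalPart Y hI hr :=
    i.restrict fun x ⟨t, ht, h⟩ => ⟨t, ht, by rw [← map_smul, h]⟩
  have hi' : Function.Injective i' := fun x y h => Subtype.ext (hi (congrArg Subtype.val h))
  obtain ⟨g, hg⟩ := hinj _ _ (isSUnital_sUnitalPart hI hr) (isSUnital_sUnitalPart hI hr) i' hi' f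
  -- Since `u y` is `s`-unital for every `u ∈ I`, the formula `G(y)(u) = g(u y)` makes sense on all
  -- of `Y`, although `g` lives only on the `s`-unital part.
  let G : Y →+ (I →ₗ[R] E) := AddMonoidHom.mk' (fun y =>
    { toFun := fun u => g ⟨u.1 • y, smul_mem_sUnitalPart hI hr u.2 y⟩
      map_add' := fun u v => by
        rw [← map_add]; exact congrArg g (Subtype.ext (add_smul u.1 v.1 y))
      map_smul' := fun b u => by
        rw [RingHom.id_apply, ← map_smul]; exact congrArg g (Subtype.ext (mul_smul b u.1 y)) })
    fun y z => LinearMap.ext fun u => by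
      change g _ = g _ + g _
      rw [← map_add]
      exact congrArg g (Subtype.ext (smul_add u.1 y z))
  refine ⟨G, fun b y u => congrArg g (Subtype.ext (smul_smul u.1 b y)), fun x => ?_⟩
  refine LinearMap.ext fun u => ?_
  have h1 : G (i x) u = f ⟨u.1 • x, smul_mem_sUnitalPart hI hr u.2 x⟩ := by
    rw [← hg]
    exact congrArg g (Subtype.ext (map_smul i u.1 x).symm)
  rw [h1]
  refine huniq fun v => ?_
  change F (u.1 • x) v = _
  rw [hF, ← map_smul]
  rfl

end SUnital

/-! ### Consequences of local projectivity and of exactness of `Rat_C` -/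

section Rational

variable {K C : Type u} [CommRing K] [AddCommGroup C] [Module K C]

/-- Finitely many elements of a locally projective module admit a finite dual basis. -/
theorem IsLocallyProjective.exists_dualBasis (hC : IsLocallyProjective K C) {ι : Type*} [Finite ι]
    (c : ι → C) :
    ∃ (s : Finset C) (e : C → C →ₗ[K] K), ∀ i, c i = ∑ d ∈ s, e d (c i) • d := by
  classical
  cases nonempty_fintype ι
  -- The canonical surjection from the free module on the set `C` has a section over the span of the
  -- given elements. The coordinates of that section are the dual basis.
  obtain ⟨h, hh⟩ := hC (C →₀ K) C (Finsupp.linearCombination K id)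
    (Finsupp.linearCombination_id_surjective K C) LinearMap.id
    (Submodule.span K (Set.range c)) (Submodule.fg_span (Set.finite_range c))
  refine ⟨Finset.univ.biUnion fun i => (h (c i)).support, fun d => Finsupp.lapply d ∘ₗ h,
    fun i => ?_⟩
  have := hh (c i) (Submodule.subset_span ⟨i, rfl⟩)
  rw [Finsupp.linearCombination_apply, Finsupp.sum_of_support_subset
    (s := Finset.univ.biUnion fun i => (h (c i)).support) _
    (Finset.subset_biUnion_of_mem (fun i => (h (c i)).support) (Finset.mem_univ i)) _
    (by simp)] at this
  exact this.symm

/-- If `C` is locally projective, an element of `N ⊗ C` is determined by its images under all the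
maps `id ⊗ x` with `x ∈ C*`. -/
theorem IsLocallyProjective.tensor_ext (hC : IsLocallyProjective K C) {N : Type*} [AddCommGroup N]
    [Module K N] {z w : N ⊗[K] C}
    (h : ∀ x : C →ₗ[K] K, TensorProduct.rid K N (x.lTensor N z) =
      TensorProduct.rid K N (x.lTensor N w)) : z = w := by
  rw [← sub_eq_zero]
  have h0 : ∀ x : C →ₗ[K] K, TensorProduct.rid K N (x.lTensor N (z - w)) = 0 := fun x => by
    rw [map_sub, map_sub, h, sub_self]
  generalize z - w = v at h0
  obtain ⟨S, rfl⟩ := TensorProduct.exists_finset (R := K) v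
  obtain ⟨s, e, he⟩ := hC.exists_dualBasis (fun i : S => i.1.2)
  -- Expanding the second factors in the dual basis, the element becomes `∑ (id ⊗ e_d)(v) ⊗ d`, and
  -- each coefficient vanishes by hypothesis.
  have h1 : ∀ i ∈ S, i.1 ⊗ₜ[K] i.2 = ∑ d ∈ s, (e d i.2 • i.1) ⊗ₜ[K] d := fun i hi => by
    conv_lhs => rw [he ⟨i, hi⟩]
    simp only [TensorProduct.tmul_sum, TensorProduct.tmul_smul, TensorProduct.smul_tmul']
  rw [Finset.sum_congr rfl h1, Finset.sum_comm]
  refine Finset.sum_eq_zero fun d _ => ?_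
  rw [← TensorProduct.sum_tmul]
  have := h0 (e d)
  simp only [map_sum, LinearMap.lTensor_tmul, TensorProduct.rid_tmul] at this
  rw [this, TensorProduct.zero_tmul]

variable [Coalgebra K C]

/-- The element `m` is rational and dies in the quotient of `X` by `C* m`. Exactness of `Rat_C` at
`X` therefore lifts it along `x ↦ x m` to a rational element of `C*`. -/
theorem exists_rat_smul_eq (hRat : RatIsExact K C) {X : Type u} [AddCommGroup X]
    [Module (ConvDual K C) X] {m : X} (hm : IsRational K C m) :
    ∃ t ∈ rat K C (ConvDual K C), t • m = m := by
  let f : ConvDual K C →ₗ[ConvDual K C] X := LinearMap.toSpanSingleton _ X m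
  have hex : Function.Exact f (LinearMap.range f).mkQ :=
    LinearMap.exact_iff.2 (Submodule.ker_mkQ _)
  obtain ⟨t, ht⟩ := (hRat _ _ _ f _ hex ⟨m, hm⟩).1 (Subtype.ext
    ((Submodule.Quotient.mk_eq_zero _).2 ⟨1, one_smul _ m⟩))
  exact ⟨t.1, t.2, congrArg Subtype.val ht⟩

theorem rat_mul_mem {t : ConvDual K C} (ht : t ∈ rat K C (ConvDual K C)) (x : ConvDual K C) :
    t * x ∈ rat K C (ConvDual K C) :=
  IsRational.map (LinearMap.toSpanSingleton (ConvDual K C) (ConvDual K C) x) ht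

end Rational

/-! ### Stability of `Rat_C(C*)` under the action of `H` -/

section Antipode

variable {K H : Type u} [CommRing K] [Ring H] [HopfAlgebra K H]

/-- `∑ S(h₁) h₂ ⊗ h₃ = 1 ⊗ h`. -/
theorem antipode_cancel (h : H) :
    LinearMap.rTensor H (LinearMap.mul' K H ∘ₗ (HopfAlgebra.antipode K).rTensor H)
      ((TensorProduct.assoc K H H H).symm ((Coalgebra.comul (R := K)).lTensor H
        (Coalgebra.comul (R := K) h))) = 1 ⊗ₜ h := by
  rw [Coalgebra.coassoc_symm_apply, ← LinearMap.comp_apply, ← LinearMap.rTensor_comp,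
    LinearMap.comp_assoc, HopfAlgebra.mul_antipode_rTensor_comul, LinearMap.rTensor_comp,
    LinearMap.comp_apply, Coalgebra.rTensor_counit_comul]
  simp

end Antipode

section RatAct

variable {K H C : Type u} [CommRing K] [Ring H] [HopfAlgebra K H]
  [AddCommGroup C] [Module K C] [Coalgebra K C] [Module H C] [IsScalarTower K H C]
  [LeftModuleCoalgebra K H C]

/-- `x (t h) = ∑ ((x S(h₁)) t) h₂`. -/
theorem mul_dualAct_eq (x t : ConvDual K C) (h : H) :
    x * dualAct K H C t h = TensorProduct.lift ((LinearMap.compl₁₂ (dualAct K H C)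
      (LinearMap.mulRight K t ∘ₗ dualAct K H C x ∘ₗ HopfAlgebra.antipode K) LinearMap.id))
      (Coalgebra.comul (R := K) h) := by
  let Ω : H ⊗[K] H →ₗ[K] ConvDual K C := LinearMap.mul' K (ConvDual K C) ∘ₗ
    TensorProduct.map (dualAct K H C x) (dualAct K H C t)
  have h1 : x * dualAct K H C t h = Ω (1 ⊗ₜ h) := by simp [Ω, dualAct_one]
  -- With `1 ⊗ h` replaced by `∑ S(h₁) h₂ ⊗ h₃`, the product becomes `∑ (x S(h₁) h₂)(t h₃)`, and
  -- multiplicativity of the `H`-action on `C*` merges `h₂` and `h₃`.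
  rw [h1, ← antipode_cancel (K := K)]
  generalize Coalgebra.comul (R := K) h = z
  induction z with
  | zero => simp
  | add s t hs ht => simp only [map_add, hs, ht]
  | tmul a b =>
    simp only [LinearMap.lTensor_tmul, TensorProduct.lift.tmul, LinearMap.compl₁₂_apply,
      LinearMap.comp_apply, LinearMap.mulRight_apply, LinearMap.id_apply]
    rw [mul_dualAct]
    generalize Coalgebra.comul (R := K) b = w
    induction w with
    | zero => simp
    | add s t hs ht => simp only [map_add, TensorProduct.tmul_add, hs, ht]
    | tmul b c => simp [Ω, dualAct_mul]

/-- By `mul_dualAct_eq`, left multiplication of `t h` by `x` reduces to left multiplication of `t`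
by `x S(h₁)`. Parameters `(cᵢ, tᵢ)` of `t` thus give parameters `(S(h₁) cᵢ, tᵢ h₂)` of `t h`. -/
theorem dualAct_mem_rat {t : ConvDual K C} (ht : t ∈ rat K C (ConvDual K C)) (h : H) :
    dualAct K H C t h ∈ rat K C (ConvDual K C) := by
  obtain ⟨n, c, t', ht⟩ := ht
  have key : ∀ z : H ⊗[K] H, HasParams (fun x : ConvDual K C =>
      TensorProduct.lift ((LinearMap.compl₁₂ (dualAct K H C)
      (LinearMap.mulRight K t ∘ₗ dualAct K H C x ∘ₗ HopfAlgebra.antipode K) LinearMap.id)) z) := by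
    intro z
    induction z with
    | zero => simpa only [map_zero] using HasParams.zero
    | add s t hs ht => simpa only [map_add] using hs.add ht
    | tmul a b =>
      refine ⟨n, fun i => HopfAlgebra.antipode K a • c i, fun i => dualAct K H C (t' i) b,
        fun x => ?_⟩
      have h1 : dualAct K H C x (HopfAlgebra.antipode K a) * t = _ :=
        ht (dualAct K H C x (HopfAlgebra.antipode K a))
      simp only [TensorProduct.lift.tmul, LinearMap.compl₁₂_apply, LinearMap.comp_apply,
        LinearMap.mulRight_apply, LinearMap.id_apply, h1, map_sum, LinearMap.sum_apply]
      refine Finset.sum_congr rfl fun i _ => ?_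
      rw [algebraMap_smul, algebraMap_smul, map_smul, LinearMap.smul_apply]
      rfl
  obtain ⟨n, c, m', hm⟩ := key (Coalgebra.comul (R := K) h)
  exact ⟨n, c, m', fun x => by rw [smul_eq_mul, mul_dualAct_eq]; exact hm x⟩

end RatAct

/-! ### The ideal `𝔞` as `A ⊗ Rat_C(C*)`, and bijectivity of `hatMap` -/

section HatMap

variable {K H A C : Type u} [CommRing K] [Ring H] [HopfAlgebra K H]
  [Ring A] [Algebra K A] [RightComoduleAlgebra K H A]
  [AddCommGroup C] [Module K C] [Coalgebra K C] [Module H C] [IsScalarTower K H C]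
  [LeftModuleCoalgebra K H C]

variable (K C) in
/-- `Rat_C(C*)` as a `K`-module. -/
abbrev ratK : Submodule K (ConvDual K C) := (rat K C (ConvDual K C)).restrictScalars K

variable (K A C) in
/-- The map `A ⊗ Rat_C(C*) → A # C*`. -/
def ratTensor : A ⊗[K] ratK K C →ₗ[K] A ⊗[K] ConvDual K C := (ratK K C).subtype.lTensor A

/-- Together with `exists_ratTensor_eq`, this identifies `A ⊗ Rat_C(C*)` with `𝔞`. -/
theorem ratTensor_injective (hA : Module.Flat K A) : Function.Injective (ratTensor K A C) :=
  Module.Flat.lTensor_preserves_injective_linearMap _ (Submodule.injective_subtype _)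

variable (K H) in
/-- For `r ∈ Rat_C(C*)` and `x ∈ C*`, the map `h ↦ (x h) r` with values in `Rat_C(C*)`. -/
def twistRat (x : ConvDual K C) (r : ratK K C) : H →ₗ[K] ratK K C :=
  (twist K H C x r.1).codRestrict (ratK K C) fun h => IsRational.smul (dualAct K H C x h) r.2

theorem ratTensor_map_twistRat (b : A) (x : ConvDual K C) (r : ratK K C) (t : A ⊗[K] H) :
    ratTensor K A C (TensorProduct.map (LinearMap.mulLeft K b) (twistRat K H x r) t) =
      TensorProduct.map (LinearMap.mulLeft K b) (twist K H C x r.1) t := by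
  induction t with
  | zero => simp
  | add s t hs ht => simp only [map_add, hs, ht]
  | tmul a h => rfl

/-- The ideal of rational elements of `A # C*` is the image of `A ⊗ Rat_C(C*)`. -/
theorem exists_ratTensor_eq (hRat : RatIsExact K C) {u : Smash K H A C} (hu : IsRational K C u) :
    ∃ w, Smash.ofTensor K H A C (ratTensor K A C w) = u := by
  -- Writing `u = t u`, it is enough to treat `(1 # t)(a # x) = ∑ a₀ # (t a₁) x`. The second factors
  -- are rational because `Rat_C(C*)` is `H`-stable and a right ideal.
  obtain ⟨t, ht, h⟩ := exists_rat_smul_eq hRat hu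
  rw [← h]
  clear h hu
  induction u using Smash.induction_on with
  | zero => exact ⟨0, by rw [map_zero, map_zero, smul_zero]⟩
  | add u v hu hv =>
    obtain ⟨w, hw⟩ := hu
    obtain ⟨w', hw'⟩ := hv
    exact ⟨w + w', by rw [map_add, map_add, hw, hw', smul_add]⟩
  | mk a x =>
    rw [dual_smul_smash, Smash.mk_mul_mk]
    generalize RightComoduleAlgebra.coact (K := K) (H := H) a = z
    induction z with
    | zero => exact ⟨0, by simp⟩
    | add s t hs ht =>
      obtain ⟨w, hw⟩ := hs
      obtain ⟨w', hw'⟩ := ht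
      exact ⟨w + w', by simp only [map_add, hw, hw']⟩
    | tmul b h =>
      exact ⟨(1 * b) ⊗ₜ ⟨dualAct K H C t h * x, rat_mul_mem (dualAct_mem_rat ht h) x⟩, rfl⟩

theorem Smash.mk_mul_one_mk (a : A) (x y : ConvDual K C) :
    Smash.mk K H a x * Smash.mk K H 1 y = Smash.mk K H a (x * y) := by
  rw [Smash.mk_mul_mk, map_one (RightComoduleAlgebra.coact (K := K) (H := H) (A := A)),
    Algebra.TensorProduct.one_def, TensorProduct.map_tmul, twist_apply,
    dualAct_one, LinearMap.mulLeft_apply, mul_one]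
  rfl

theorem mk_mem_ratIdeal (a : A) (r : ratK K C) :
    Smash.mk K H a r.1 ∈ ratIdeal K H A C := by
  have := (ratIdeal K H A C).smul_mem (Smash.mk K H a 1) (ratIdealOfRat K H A r).2
  rwa [show Smash.mk K H a 1 • (ratIdealOfRat K H A r).1 = Smash.mk K H a r.1 from
    Smash.mk_mul_one_mk a 1 r.1 |>.trans (by rw [one_mul])] at this

theorem isSUnital_ratIdeal (hRat : RatIsExact K C) :
    IsSUnital (ratIdeal K H A C) (ratIdeal K H A C) := by
  rintro ⟨u, hu⟩
  obtain ⟨t, ht, h⟩ := exists_rat_smul_eq hRat hu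
  exact ⟨Smash.mk K H 1 t, (ratIdealOfRat K H A ⟨t, ht⟩).2, Subtype.ext h⟩

namespace DKMod

theorem algebraMap_smul_eq (E : DKMod K H A C) (k : K) (e : E) :
    algebraMap K (ConvDual K C) k • e = k • e := by
  change E.dualEnd _ e = _
  rw [Algebra.algebraMap_eq_smul_one, map_smul, dualEnd_one]
  rfl

theorem dual_smul_eq (E : DKMod K H A C) (x : ConvDual K C) (e : E) :
    Smash.mk K H (1 : A) x • e = x • e := (mk_smul E 1 x e).trans (one_smul A _)

/-- The map `A ⊗ Rat_C(C*) → E`, `a ⊗ r ↦ a g(r)`, for `g : Rat_C(C*) → E`. -/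
def ratLift (E : DKMod K H A C) (g : E.RatHom) : A ⊗[K] ratK K C →ₗ[K] E :=
  TensorProduct.lift (LinearMap.compl₂ (Algebra.lsmul K K E : A →ₐ[K] Module.End K E).toLinearMap
    { toFun := fun r => g r
      map_add' := fun r s => map_add g _ _
      map_smul' := fun k r => by
        rw [RingHom.id_apply, ← algebraMap_smul_eq]
        refine Eq.trans (congrArg g (Subtype.ext ?_)) (map_smul g _ _)
        exact (algebraMap_smul (ConvDual K C) k r.1).symm })

theorem ratLift_tmul (E : DKMod K H A C) (g : E.RatHom) (a : A) (r : ratK K C) :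
    E.ratLift g (a ⊗ₜ r) = a • g r := rfl

/-- This is the `A # C*`-linearity of `ratLift`, phrased without putting an `A # C*`-action on `A ⊗
Rat_C(C*)`. For `b # x` and `a ⊗ r` the witness is `∑ b a₀ ⊗ (x a₁) r`, and the compatibility `x (a
e) = ∑ a₀ ((x a₁) e)` in `E` matches it. -/
theorem exists_ratLift_smul (E : DKMod K H A C) (g : E.RatHom) (s : Smash K H A C)
    (w : A ⊗[K] ratK K C) :
    ∃ w', Smash.ofTensor K H A C (ratTensor K A C w') =
        s * Smash.ofTensor K H A C (ratTensor K A C w) ∧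
      E.ratLift g w' = s • E.ratLift g w := by
  induction s using Smash.induction_on with
  | zero => exact ⟨0, by simp, by simp⟩
  | add s t hs ht =>
    obtain ⟨w₁, h1, h2⟩ := hs
    obtain ⟨w₂, h3, h4⟩ := ht
    exact ⟨w₁ + w₂, by rw [map_add, map_add, h1, h3, add_mul], by rw [map_add, h2, h4, add_smul]⟩
  | mk b x =>
    induction w with
    | zero => exact ⟨0, by simp, by simp⟩
    | add s t hs ht =>
      obtain ⟨w₁, h1, h2⟩ := hs
      obtain ⟨w₂, h3, h4⟩ := ht
      exact ⟨w₁ + w₂, by simp only [map_add, h1, h3, mul_add],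
        by simp only [map_add, h2, h4, smul_add]⟩
    | tmul a r =>
      refine ⟨TensorProduct.map (LinearMap.mulLeft K b) (twistRat K H x r)
        (RightComoduleAlgebra.coact (K := K) (H := H) a), ?_, ?_⟩
      · refine (congrArg (Smash.ofTensor K H A C) (ratTensor_map_twistRat b x r _)).trans ?_
        exact (Smash.mk_mul_mk K H b a x r.1).symm
      · rw [ratLift_tmul, mk_smul]
        change _ = b • E.dualEnd x (a • g r)
        rw [dualEnd_smul]
        generalize RightComoduleAlgebra.coact (K := K) (H := H) a = z
        induction z with
        | zero => simp
        | add s t hs ht => simp only [map_add, LinearMap.add_apply, smul_add, hs, ht]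
        | tmul a h =>
          simp only [TensorProduct.map_tmul, ratLift_tmul, smashEnd_tmul, LinearMap.mulLeft_apply,
            LinearMap.id_apply, mul_smul]
          exact congrArg (b • a • ·) (map_smul g (dualAct K H C x h) r)

/-- Since `a # r = (a # 1)(1 # r)`, a linear map on `𝔞` is determined by its values on the elements
`1 # r`. Conversely `ratLift` extends any `C*`-linear `g`, and it descends to `𝔞` because flatness
makes preimages in `A ⊗ Rat_C(C*)` unique. -/
theorem hatMap_bijective (hA : Module.Flat K A) (hRat : RatIsExact K C) (E : DKMod K H A C) :
    Function.Bijective E.hatMap := by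
  constructor
  · rw [injective_iff_map_eq_zero]
    intro f hf
    have key : ∀ w : A ⊗[K] ratK K C, ∃ h,
        f ⟨Smash.ofTensor K H A C (ratTensor K A C w), h⟩ = 0 := by
      intro w
      induction w with
      | zero => exact ⟨IsRational.zero, map_zero f⟩
      | add s t hs ht =>
        obtain ⟨h, hs⟩ := hs
        obtain ⟨h', ht⟩ := ht
        have hst : Smash.ofTensor K H A C (ratTensor K A C (s + t)) =
            Smash.ofTensor K H A C (ratTensor K A C s) +
              Smash.ofTensor K H A C (ratTensor K A C t) := by rw [map_add, map_add]
        refine ⟨hst ▸ (ratIdeal K H A C).add_mem h h', ?_⟩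
        refine (congrArg f (Subtype.ext hst)).trans ((map_add f ⟨_, h⟩ ⟨_, h'⟩).trans ?_)
        rw [hs, ht, add_zero]
      | tmul a r =>
        refine ⟨mk_mem_ratIdeal a r, ?_⟩
        have h1 : f (ratIdealOfRat K H A r) = 0 := LinearMap.congr_fun hf r
        rw [← smul_zero (Smash.mk K H a (1 : ConvDual K C)), ← h1, ← map_smul]
        refine congrArg f (Subtype.ext ?_)
        have h2 := Smash.mk_mul_one_mk (K := K) (H := H) a (1 : ConvDual K C) r.1
        rw [one_mul] at h2
        exact h2.symm
    ext ⟨u, hu⟩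
    obtain ⟨w, rfl⟩ := exists_ratTensor_eq hRat hu
    exact (key w).2
  · intro g
    choose φ hφ using fun u : ratIdeal K H A C => exists_ratTensor_eq hRat u.2
    have huniq : ∀ {u : ratIdeal K H A C} {w}, Smash.ofTensor K H A C (ratTensor K A C w) = u.1 →
        φ u = w := fun {u w} h => ratTensor_injective hA
          ((Smash.ofTensor K H A C).injective ((hφ u).trans h.symm))
    refine ⟨{ toFun := fun u => E.ratLift g (φ u), map_add' := fun u v => ?_,
              map_smul' := fun s u => ?_ }, LinearMap.ext fun r => ?_⟩
    · rw [← map_add, huniq (u := u + v) (w := φ u + φ v) (by rw [map_add, map_add, hφ, hφ]; rfl)]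
    · obtain ⟨w', h1, h2⟩ := E.exists_ratLift_smul g s (φ u)
      rw [RingHom.id_apply, ← h2, huniq (u := s • u) (w := w') (by rw [h1, hφ]; rfl)]
    · change E.ratLift g (φ (ratIdealOfRat K H A r)) = g r
      rw [huniq (u := ratIdealOfRat K H A r) (w := (1 : A) ⊗ₜ[K] (⟨r.1, r.2⟩ : ratK K C)) rfl]
      exact one_smul A (g r)

end DKMod

end HatMap

/-! ### Doi-Koppinen modules are the `s`-unital `A # C*`-modules -/

section Equivalence

variable {K H A C : Type u} [CommRing K] [Ring H] [HopfAlgebra K H]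
  [Ring A] [Algebra K A] [RightComoduleAlgebra K H A]
  [AddCommGroup C] [Module K C] [Coalgebra K C] [Module H C] [IsScalarTower K H C]
  [LeftModuleCoalgebra K H C]

/-- The unit of `C*` satisfies `ε h = ε(h) ε`, so counitality absorbs the coaction on `b`. -/
theorem Smash.mk_one_mul_mk_one (a b : A) :
    Smash.mk K H a 1 * Smash.mk K H b 1 = Smash.mk K H (A := A) (C := C) (a * b) 1 := by
  have h : twist K H C (1 : ConvDual K C) 1 =
      LinearMap.toSpanSingleton K (ConvDual K C) 1 ∘ₗ Coalgebra.counit := by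
    ext h : 1
    rw [twist_apply, mul_one, one_dualAct]
    rfl
  have hb := LinearMap.congr_fun (RightComoduleAlgebra.counit_coact (K := K) (H := H) (A := A)) b
  simp only [LinearMap.comp_apply, LinearMap.id_apply] at hb
  rw [Smash.mk_mul_mk, h]
  change _ = Smash.ofTensor K H A C ((a * b) ⊗ₜ[K] 1)
  congr 1
  conv_rhs => rw [← hb]
  change _ = (a * TensorProduct.rid K A (LinearMap.lTensor A Coalgebra.counit
      (RightComoduleAlgebra.coact (K := K) (H := H) b))) ⊗ₜ[K] 1
  generalize RightComoduleAlgebra.coact (K := K) (H := H) b = t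
  induction t with
  | zero => simp
  | add s t hs ht => simp only [map_add, TensorProduct.add_tmul, mul_add, hs, ht]
  | tmul b h => simp [TensorProduct.smul_tmul]

theorem Smash.mk_add (a b : A) (x : ConvDual K C) :
    Smash.mk K H (a + b) x = Smash.mk K H a x + Smash.mk K H b x :=
  TensorProduct.add_tmul a b x

variable (K H A C) in
/-- The ring homomorphism `A → A # C*`, `a ↦ a # 1`. -/
def Smash.ofBase : A →+* Smash K H A C where
  toFun a := Smash.mk K H a 1
  map_one' := rfl
  map_zero' := TensorProduct.zero_tmul _ _
  map_add' a b := Smash.mk_add a b 1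
  map_mul' a b := (Smash.mk_one_mul_mk_one a b).symm

section Construction

variable {X : Type u} [AddCommGroup X] [Module (Smash K H A C) X] [Module K X] [Module A X]
  [IsScalarTower K A X]

/-- The `A`-module structure (and with it the `K`-module structure) of an `A # C*`-module is the
one obtained through `A → A # C*`. -/
def IsRestriction (K H A C X : Type u) [CommRing K] [Ring H] [HopfAlgebra K H]
    [Ring A] [Algebra K A] [RightComoduleAlgebra K H A]
    [AddCommGroup C] [Module K C] [Coalgebra K C] [Module H C] [IsScalarTower K H C]
    [LeftModuleCoalgebra K H C] [AddCommGroup X] [Module (Smash K H A C) X] [Module A X] : Prop :=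
  ∀ (a : A) (m : X), Smash.mk K H a (1 : ConvDual K C) • m = a • m

theorem IsRestriction.smul_eq (hX : IsRestriction K H A C X) (k : K) (u : Smash K H A C) (m : X) :
    (k • u) • m = k • u • m := by
  have h : k • (1 : Smash K H A C) = Smash.mk K H (k • 1) 1 :=
    (TensorProduct.smul_tmul' k (1 : A) (1 : ConvDual K C))
  have h2 : (k • (1 : Smash K H A C)) * u = k • (1 * u) :=
    LinearMap.map_smul₂ (smashMul K H A C) k _ u
  rw [← one_mul u, ← h2, mul_smul, h, hX, smul_assoc, one_smul, one_mul]

/-- The elements of an `s`-unital `A # C*`-module have parameters in `X ⊗ C`. -/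
theorem exists_coact (hX : IsRestriction K H A C X) (hu : IsSUnital (ratIdeal K H A C) X) (m : X) :
    ∃ z : X ⊗[K] C, ∀ x : ConvDual K C,
      TensorProduct.rid K X (x.ofConv.lTensor X z) = Smash.mk K H (1 : A) x • m := by
  -- Here `m = t m` with `t` rational in `A # C*`, and parameters of `t` yield parameters `t'ᵢ m` of
  -- `m`.
  obtain ⟨t, ⟨n, c, t', ht⟩, h⟩ := hu m
  refine ⟨∑ i, (t' i • m) ⊗ₜ c i, fun x => ?_⟩
  rw [← h]
  conv_rhs => rw [smul_smul, ← dual_smul_smash, ht, Finset.sum_smul]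
  simp only [map_sum, LinearMap.lTensor_tmul, TensorProduct.rid_tmul, h, algebraMap_smul_smash,
    hX.smul_eq]

/-- The coaction of `C` on an `s`-unital `A # C*`-module. -/
def coactOf (hC : IsLocallyProjective K C) (hX : IsRestriction K H A C X)
    (hu : IsSUnital (ratIdeal K H A C) X) : X →ₗ[K] X ⊗[K] C where
  -- By local projectivity the chosen element is the only possible one, and its additivity and
  -- `K`-linearity follow from this uniqueness.
  toFun m := (exists_coact hX hu m).choose
  map_add' m n := hC.tensor_ext fun x => by
    have h := fun m => (exists_coact hX hu m).choose_spec (WithConv.toConv x)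
    dsimp only at h
    rw [map_add, map_add, h, h, h, smul_add]
  map_smul' k m := hC.tensor_ext fun x => by
    have h := fun m => (exists_coact hX hu m).choose_spec (WithConv.toConv x)
    have h1 : ∀ n : X, k • n = Smash.mk K H (k • (1 : A)) (1 : ConvDual K C) • n := fun n => by
      rw [hX, smul_assoc, one_smul]
    have h2 : k • (1 : Smash K H A C) = Smash.mk K H (k • 1) 1 :=
      (TensorProduct.smul_tmul' k (1 : A) (1 : ConvDual K C))
    dsimp only at h
    rw [RingHom.id_apply, map_smul, map_smul, h, h, h1 m, ← h2, smul_smul, Smash.mul_smul_comm,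
      mul_one, hX.smul_eq]

theorem coactOf_spec (hC : IsLocallyProjective K C) (hX : IsRestriction K H A C X)
    (hu : IsSUnital (ratIdeal K H A C) X) (m : X) (x : ConvDual K C) :
    TensorProduct.rid K X (x.ofConv.lTensor X (coactOf hC hX hu m)) =
      Smash.mk K H (1 : A) x • m :=
  (exists_coact hX hu m).choose_spec x

/-- The Doi-Koppinen module given by an `s`-unital `A # C*`-module. -/
def dkOf (hC : IsLocallyProjective K C) (hX : IsRestriction K H A C X)
    (hu : IsSUnital (ratIdeal K H A C) X) : DKMod K H A C where
  carrier := X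
  coact := coactOf hC hX hu
  coassoc := by
    ext m
    -- Pairing both copies of `C` with functionals turns coassociativity into `(1 # x)(1 # y) m = (1
    -- # x y) m`.
    refine (TensorProduct.assoc K X C C).symm.injective (hC.tensor_ext fun y =>
      hC.tensor_ext fun x => ?_)
    have h1 : TensorProduct.rid K (X ⊗[K] C) (y.lTensor (X ⊗[K] C)
        ((coactOf hC hX hu).rTensor C (coactOf hC hX hu m))) =
        coactOf hC hX hu (Smash.mk K H (1 : A) (WithConv.toConv y) • m) := by
      rw [← coactOf_spec hC hX hu]
      generalize coactOf hC hX hu m = t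
      induction t with
      | zero => simp
      | add s t hs ht => simp only [map_add, hs, ht]
      | tmul m c => simp
    have h2 : ∀ t : X ⊗[K] C, TensorProduct.rid K X (x.lTensor X
        (TensorProduct.rid K (X ⊗[K] C) (y.lTensor (X ⊗[K] C) ((TensorProduct.assoc K X C C).symm
          ((Coalgebra.comul (R := K)).lTensor X t))))) =
        TensorProduct.rid K X ((WithConv.toConv x * WithConv.toConv y).ofConv.lTensor X t) := by
      intro t
      induction t with
      | zero => simp
      | add s t hs ht => simp only [map_add, hs, ht]
      | tmul m c =>
        simp only [LinearMap.lTensor_tmul, TensorProduct.rid_tmul]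
        change _ = LinearMap.mul' K K (TensorProduct.map x y (Coalgebra.comul (R := K) c)) • m
        generalize Coalgebra.comul (R := K) c = w
        induction w with
        | zero => simp
        | add s t hs ht => simp only [map_add, add_smul, TensorProduct.tmul_add, hs, ht]
        | tmul c d => simp [smul_smul, mul_comm]
    simp only [LinearMap.comp_apply, LinearEquiv.coe_coe, LinearEquiv.symm_apply_apply, h1, h2]
    refine (coactOf_spec hC hX hu _ (WithConv.toConv x)).trans ?_
    rw [coactOf_spec, smul_smul, Smash.mk_mul_one_mk]
  counit_coact := by
    ext m
    exact (coactOf_spec hC hX hu m 1).trans (one_smul _ m)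
  coact_smul a m := by
    -- Paired with `x`, the compatibility becomes the relation `(1 # x)(a # 1) = ∑ a₀ # (x a₁)`
    -- applied to `m`.
    refine hC.tensor_ext fun x => ?_
    have h1 : ∀ z : A ⊗[K] H, TensorProduct.rid K X (x.lTensor X
        (diagAct K A H X C z (coactOf hC hX hu m))) = Smash.ofTensor K H A C
          (TensorProduct.map (LinearMap.mulLeft K 1) (twist K H C (WithConv.toConv x) 1) z) •
            m := by
      intro z
      induction z with
      | zero => simp
      | add s t hs ht => simp only [map_add, LinearMap.add_apply, add_smul, hs, ht]
      | tmul b h =>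
        have h2 : ∀ w : X ⊗[K] C, TensorProduct.rid K X (x.lTensor X
            (diagAct K A H X C (b ⊗ₜ h) w)) = b • TensorProduct.rid K X
              ((dualAct K H C (WithConv.toConv x) h).ofConv.lTensor X w) := by
          intro w
          induction w with
          | zero => simp
          | add s t hs ht => simp only [map_add, smul_add, hs, ht]
          | tmul m c =>
            simp only [diagAct_tmul, LinearMap.lTensor_tmul, TensorProduct.rid_tmul]
            exact (smul_comm b (x (h • c)) m).symm
        rw [h2, coactOf_spec, ← hX, smul_smul, Smash.mk_mul_one_mk, TensorProduct.map_tmul,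
          twist_apply, LinearMap.mulLeft_apply, one_mul, one_mul, mul_one]
        rfl
    refine (coactOf_spec hC hX hu _ (WithConv.toConv x)).trans ?_
    rw [h1, ← hX, smul_smul, Smash.mk_mul_mk]

theorem dkOf_smul (hC : IsLocallyProjective K C) (hX : IsRestriction K H A C X)
    (hu : IsSUnital (ratIdeal K H A C) X) (u : Smash K H A C) (m : X) :
    (dkOf hC hX hu).smashEnd u m = u • m := by
  induction u using Smash.induction_on with
  | zero =>
    rw [zero_smul]
    exact LinearMap.congr_fun (map_zero (dkOf hC hX hu).smashEnd) m
  | add u v h h' =>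
    rw [add_smul, ← h, ← h']
    exact LinearMap.congr_fun (map_add (dkOf hC hX hu).smashEnd u v) m
  | mk a x =>
    have h : a • Smash.mk K H (1 : A) x • m = Smash.mk K H a x • m := by
      rw [← hX, smul_smul, Smash.mk_mul_one_mk, one_mul]
    exact (congrArg (a • ·) (coactOf_spec hC hX hu m x)).trans h

end Construction

/-- Every `s`-unital `A # C*`-module comes from a Doi-Koppinen module. -/
theorem exists_dkMod (hC : IsLocallyProjective K C) (X : Type u) [AddCommGroup X]
    [Module (Smash K H A C) X] (hu : IsSUnital (ratIdeal K H A C) X) :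
    ∃ D : DKMod K H A C, Nonempty (D ≃ₗ[Smash K H A C] X) := by
  let _ : Module A X := Module.compHom X (Smash.ofBase K H A C)
  let _ : Module K X := Module.compHom X (algebraMap K A)
  have : IsScalarTower K A X := ⟨fun k a x => by
    rw [Algebra.smul_def, mul_smul]; rfl⟩
  have hX : IsRestriction K H A C X := fun a m => rfl
  exact ⟨dkOf hC hX hu, ⟨{ AddEquiv.refl X with map_smul' := fun u m => dkOf_smul hC hX hu u m }⟩⟩

namespace DKMod

theorem isRational (M : DKMod K H A C) (m : M) : IsRational K C m := by
  have key : ∀ z : M ⊗[K] C, HasParams (fun x : ConvDual K C =>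
      TensorProduct.rid K M (x.ofConv.lTensor M z)) := by
    intro z
    induction z with
    | zero => simpa only [map_zero] using HasParams.zero
    | add s t hs ht => simpa only [map_add] using hs.add ht
    | tmul m c =>
      exact ⟨1, fun _ => c, fun _ => m, fun x => by
        rw [Fin.sum_univ_one, algebraMap_smul_eq]; rfl⟩
  exact key (M.coact m)

theorem exists_rat_smul_eq (hRat : RatIsExact K C) (M : DKMod K H A C) (m : M) :
    ∃ t ∈ rat K C (ConvDual K C), t • m = m :=
  DoiKoppinen.exists_rat_smul_eq hRat (M.isRational m)

theorem isSUnital (hRat : RatIsExact K C) (M : DKMod K H A C) :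
    IsSUnital (ratIdeal K H A C) M := fun m => by
  obtain ⟨t, ht, h⟩ := M.exists_rat_smul_eq hRat m
  exact ⟨Smash.mk K H 1 t, (ratIdealOfRat K H A ⟨t, ht⟩).2, (M.dual_smul_eq t m).trans h⟩

/-- A morphism of Doi-Koppinen modules as an `A # C*`-linear map. -/
def Hom.toSmashLin {M N : DKMod K H A C} (f : M ⟶ N) : M →ₗ[Smash K H A C] N where
  toFun := Hom.toLin f
  map_add' := map_add _
  map_smul' := Hom.map_smash_smul f

/-- An `A # C*`-linear map of Doi-Koppinen modules is a morphism. -/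
def homOf (hC : IsLocallyProjective K C) {M N : DKMod K H A C} (f : M →ₗ[Smash K H A C] N) :
    M ⟶ N :=
  let g : M →ₗ[A] N :=
    { toFun := f
      map_add' := map_add f
      map_smul' := fun a m => by
        have h : ∀ (D : DKMod K H A C) (d : D), Smash.mk K H a (1 : ConvDual K C) • d = a • d :=
          fun D d => by rw [mk_smul, one_smul]
        rw [← h, map_smul, h, RingHom.id_apply] }
  Hom.mk g (by
    ext m
    -- Tested against all `x ∈ C*`, colinearity is just `C*`-linearity.
    refine hC.tensor_ext fun x => ?_
    have h1 : ∀ z : M ⊗[K] C, TensorProduct.rid K N (x.lTensor N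
        ((g.restrictScalars K).rTensor C z)) = f (TensorProduct.rid K M (x.lTensor M z)) := by
      intro z
      induction z with
      | zero => simp
      | add s t hs ht => simp only [map_add, hs, ht]
      | tmul m c =>
        simp only [LinearMap.rTensor_tmul, LinearMap.lTensor_tmul, TensorProduct.rid_tmul]
        exact ((g.restrictScalars K).map_smul _ _).symm
    rw [LinearMap.comp_apply, LinearMap.comp_apply, h1]
    change WithConv.toConv x • f m = f (WithConv.toConv x • m)
    rw [← dual_smul_eq, ← dual_smul_eq, map_smul])

theorem homOf_apply (hC : IsLocallyProjective K C) {M N : DKMod K H A C}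
    (f : M →ₗ[Smash K H A C] N) (m : M) : Hom.toLin (homOf hC f) m = f m := rfl

theorem hom_ext {M N : DKMod K H A C} {f g : M ⟶ N}
    (h : ∀ m, Hom.toLin f m = Hom.toLin g m) : f = g :=
  Hom.ext (LinearMap.ext h)

theorem comp_apply {M N P : DKMod K H A C} (f : M ⟶ N) (g : N ⟶ P) (m : M) :
    Hom.toLin (f ≫ g) m = Hom.toLin g (Hom.toLin f m) := rfl

/-- The kernel of `f` is a submodule of an `s`-unital module, hence itself a Doi-Koppinen module.
Its inclusion and the zero map agree after composition with `f`. -/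
theorem mono_iff_injective (hC : IsLocallyProjective K C) (hRat : RatIsExact K C)
    {M N : DKMod K H A C} (f : M ⟶ N) : Mono f ↔ Function.Injective (Hom.toLin f) := by
  constructor
  · intro hf
    rw [injective_iff_map_eq_zero]
    intro m hm
    obtain ⟨D, ⟨e⟩⟩ := exists_dkMod hC (LinearMap.ker (Hom.toSmashLin f))
      ((M.isSUnital hRat).of_injective _ (Submodule.injective_subtype _))
    have h : homOf hC ((LinearMap.ker (Hom.toSmashLin f)).subtype ∘ₗ e.toLinearMap) =
        homOf hC 0 := by
      rw [← cancel_mono f]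
      refine hom_ext fun d => ?_
      rw [comp_apply, comp_apply, homOf_apply, homOf_apply, LinearMap.zero_apply, map_zero]
      exact (e d).2
    have := congrArg (fun g => Hom.toLin g (e.symm ⟨m, hm⟩)) h
    simpa [homOf_apply] using this
  · intro hf
    refine ⟨fun g h e => hom_ext fun m => hf ?_⟩
    rw [← comp_apply, ← comp_apply, e]

/-- Both extension problems coincide, as `s`-unital modules can be replaced by isomorphic
Doi-Koppinen modules and monomorphisms are the injective maps. -/
theorem injective_iff (hC : IsLocallyProjective K C) (hRat : RatIsExact K C)
    (E : DKMod K H A C) : Injective E ↔ IsSUnitalInjective (ratIdeal K H A C) E := by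
  constructor
  · intro hE X Y _ _ _ _ hX hY i hi f
    obtain ⟨D, ⟨e⟩⟩ := exists_dkMod hC X hX
    obtain ⟨D', ⟨e'⟩⟩ := exists_dkMod hC Y hY
    have : Mono (homOf hC (e'.symm.toLinearMap ∘ₗ i ∘ₗ e.toLinearMap)) := by
      rw [mono_iff_injective hC hRat]
      exact e'.symm.injective.comp (hi.comp e.injective)
    obtain ⟨g, hg⟩ := hE.factors (homOf hC (f ∘ₗ e.toLinearMap))
      (homOf hC (e'.symm.toLinearMap ∘ₗ i ∘ₗ e.toLinearMap))
    refine ⟨Hom.toSmashLin g ∘ₗ e'.symm.toLinearMap, fun x => ?_⟩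
    have := congrArg (fun g => Hom.toLin g (e.symm x)) hg
    simp only [comp_apply, homOf_apply, LinearMap.comp_apply, LinearEquiv.coe_coe,
      LinearEquiv.apply_symm_apply] at this
    exact this
  · intro hE
    refine ⟨fun {M N} f i hi => ?_⟩
    obtain ⟨g, hg⟩ := hE M N (M.isSUnital hRat) (N.isSUnital hRat) (Hom.toSmashLin i)
      ((mono_iff_injective hC hRat i).1 hi) (Hom.toSmashLin f)
    exact ⟨homOf hC g, hom_ext hg⟩

end DKMod

end Equivalence

/-! ### Injective hulls and injectivity over `A # C*` -/

theorem IsSUnitalInjective.of_equiv {R : Type u} [Ring R] {I : Ideal R} {E E' : Type u}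
    [AddCommGroup E] [Module R E] [AddCommGroup E'] [Module R E'] (e : E ≃ₗ[R] E')
    (h : IsSUnitalInjective I E) : IsSUnitalInjective I E' := by
  intro X Y _ _ _ _ hX hY i hi f
  obtain ⟨g, hg⟩ := h X Y hX hY i hi (e.symm.toLinearMap ∘ₗ f)
  exact ⟨e.toLinearMap ∘ₗ g, fun x => by simp [hg]⟩

/-- An object with an injective hull which is itself injective is isomorphic to its hull. -/
theorem IsInjectiveHull.isIso {D : Type*} [Category D] {X E : D} {j : X ⟶ E}
    (hj : IsInjectiveHull j) (hX : Injective X) : IsIso j := by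
  have := hj.mono
  have h : j ≫ Injective.factorThru (𝟙 X) j = 𝟙 X := Injective.comp_factorThru _ _
  -- The retraction of `j` is a split epimorphism, and essentiality of `j` makes it a monomorphism.
  have hm : Mono (Injective.factorThru (𝟙 X) j) := hj.essential _ (by rw [h]; infer_instance)
  exact ⟨_, h, by rw [← cancel_mono (Injective.factorThru (𝟙 X) j), Category.assoc, h,
    Category.comp_id, Category.id_comp]⟩

namespace DKMod

variable {K H A C : Type u} [CommRing K] [Ring H] [HopfAlgebra K H]
  [Ring A] [Algebra K A] [RightComoduleAlgebra K H A]
  [AddCommGroup C] [Module K C] [Coalgebra K C] [Module H C] [IsScalarTower K H C]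
  [LeftModuleCoalgebra K H C]

/-- Doi-Koppinen modules have injective hulls. -/
theorem exists_injectiveHull (hC : IsLocallyProjective K C) (hRat : RatIsExact K C)
    (M : DKMod K H A C) : ∃ (E : DKMod K H A C) (j : M ⟶ E), IsInjectiveHull j := by
  -- The hull is the `s`-unital part of an injective hull `Q` over `A # C*`. It contains the image
  -- of `M`, which is `s`-unital.
  obtain ⟨Q, _, _, j, hj, hQ, hess⟩ := exists_module_injectiveHull (Smash K H A C) M
  have hI : IsSUnital (ratIdeal K H A C) (ratIdeal K H A C) := isSUnital_ratIdeal hRat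
  have hr : ∀ u ∈ ratIdeal K H A C, ∀ b, u * b ∈ ratIdeal K H A C :=
    fun u hu b => IsRational.smash_mul_right K H A C hu b
  obtain ⟨E, ⟨e⟩⟩ := exists_dkMod hC (sUnitalPart Q hI hr) (isSUnital_sUnitalPart hI hr)
  have hmem : ∀ m, j m ∈ sUnitalPart Q hI hr := fun m => by
    obtain ⟨t, ht, h⟩ := M.isSUnital hRat m
    exact ⟨t, ht, by rw [← map_smul, h]⟩
  let j' : M →ₗ[Smash K H A C] E := e.symm.toLinearMap ∘ₗ j.codRestrict _ hmem
  have hj' : ∀ m, ((e (j' m)).1 : Q) = j m := fun m => by simp [j']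
  refine ⟨E, homOf hC j', ⟨?_, ?_, fun {Z} g hg => ?_⟩⟩
  · rw [mono_iff_injective hC hRat]
    exact fun a b h => hj (by rw [← hj', ← hj']; exact congrArg (fun y => (e y).1) h)
  · exact (injective_iff hC hRat E).2
      ((isSUnitalInjective_sUnitalPart hI hr).of_equiv e.symm)
  · rw [mono_iff_injective hC hRat] at hg ⊢
    rw [injective_iff_map_eq_zero]
    intro y hy
    -- Regarded as a submodule of `Q`, the kernel of `g` meets the image of `M` trivially, so it
    -- vanishes.
    have hX := hess ((LinearMap.ker (Hom.toSmashLin g)).map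
      ((sUnitalPart Q hI hr).subtype ∘ₗ e.toLinearMap)) (by
        rw [eq_bot_iff]
        rintro _ ⟨⟨z, hz, rfl⟩, m, hm⟩
        have hzm : z = j' m := e.injective (Subtype.ext ((hj' m).trans hm).symm)
        have hz0 : Hom.toLin g z = 0 := hz
        have hm0 : m = 0 := by
          apply hg
          rw [map_zero, comp_apply, homOf_apply, ← hzm, hz0]
        rw [hzm, hm0]
        simp)
    have : ((e y).1 : Q) ∈ (⊥ : Submodule (Smash K H A C) Q) := by
      rw [← hX]
      exact ⟨y, hy, rfl⟩
    exact e.injective (Subtype.ext (by simpa using this))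

/-- `Hom(Rat_C(C*), E)` is an injective `A # C*`-module if `E` is an injective Doi-Koppinen
module. -/
theorem injective_ratHom (hC : IsLocallyProjective K C) (hRat : RatIsExact K C)
    (E : DKMod K H A C) (h : Function.Bijective E.hatMap) (hE : Injective E) :
    Injective (E.ratHom h) := by
  let := E.idealHomModule
  let := E.ratHomModule h
  refine (Module.injective_iff_injective_object (Smash K H A C) E.RatHom).1 ⟨?_⟩
  intro X Y _ _ _ _ i hi f
  let e := AddEquiv.ofBijective E.hatMap h
  have he : ∀ (b : Smash K H A C) (g : E.RatHom), b • g = e (b • e.symm g) := fun b g => rfl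
  -- The transferred structure makes `e` linear, so the extension problem is solved in `Hom(𝔞, E)`
  -- and carried back.
  obtain ⟨G, hG, hGi⟩ := exists_extension_hom_ideal (isSUnital_ratIdeal hRat)
    (fun u hu b => IsRational.smash_mul_right K H A C hu b) (E.isSUnital hRat)
    ((injective_iff hC hRat E).1 hE) i hi (e.symm.toAddMonoidHom.comp f.toAddMonoidHom)
    (fun b x u => by
      have : e.symm (f (b • x)) = b • e.symm (f x) := by
        rw [map_smul, he, AddEquiv.symm_apply_apply]
      exact LinearMap.congr_fun this u)
  refine ⟨{ toFun := fun y => e (G y)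
            map_add' := fun y z => by rw [map_add, map_add]
            map_smul' := fun b y => ?_ }, fun x => ?_⟩
  · rw [RingHom.id_apply, he, AddEquiv.symm_apply_apply]
    exact congrArg e (LinearMap.ext fun u => hG b y u)
  · change e (G (i x)) = f x
    rw [hGi]
    exact e.apply_symm_apply (f x)

/-- `(1 # r) φ = ζ_E(φ(r))`. -/
theorem mk_smul_ratHom (E : DKMod K H A C) (h : Function.Bijective E.hatMap) (φ : E.ratHom h)
    (r : rat K C (ConvDual K C)) :
    Smash.mk K H (1 : A) r.1 • φ = (zeta (𝟙 E) h).hom ((show E.RatHom from φ) r) := by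
  let := E.idealHomModule
  let e := AddEquiv.ofBijective E.hatMap h
  refine LinearMap.ext fun s : rat K C (ConvDual K C) => ?_
  obtain ⟨f, rfl⟩ := e.surjective φ
  change e (Smash.mk K H (1 : A) r.1 • e.symm (e f)) s = _
  rw [AddEquiv.symm_apply_apply]
  -- Evaluated at `s`, the left side is `f((1 # s)(1 # r))`, and linearity of `f` pulls out `1 # s`.
  change f (Smash.mk K H (1 : A) s.1 • ratIdealOfRat K H A r) = s.1 • f (ratIdealOfRat K H A r)
  rw [map_smul, dual_smul_eq]

/-- Some `t ∈ Rat_C(C*)` fixes `j(m)`, so `j(m) = ζ(m)(t)` is recovered from `ζ(m)`. -/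
theorem zeta_injective (hRat : RatIsExact K C) {M E : DKMod K H A C} (j : M ⟶ E)
    (h : Function.Bijective E.hatMap) (hj : Function.Injective (Hom.toLin j)) :
    Function.Injective (zeta j h).hom := by
  rw [injective_iff_map_eq_zero]
  intro m hm
  apply hj
  obtain ⟨t, ht, e⟩ := E.exists_rat_smul_eq hRat (Hom.toLin j m)
  refine e.symm.trans (Eq.trans ?_ (map_zero (Hom.toLin j)).symm)
  exact LinearMap.congr_fun (show (_ : E.RatHom) = 0 from hm) ⟨t, ht⟩

/-- For an injective hull `j` of a Doi-Koppinen module, `ζ` is an injective envelope over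
`A # C*`. -/
theorem isInjectiveHull_zeta (hC : IsLocallyProjective K C) (hRat : RatIsExact K C)
    {M E : DKMod K H A C} (j : M ⟶ E) (h : Function.Bijective E.hatMap) (hj : IsInjectiveHull j) :
    IsInjectiveHull (zeta j h) where
  mono := (ModuleCat.mono_iff_injective _).2
    (zeta_injective hRat j h ((mono_iff_injective hC hRat j).1 hj.mono))
  injective := injective_ratHom hC hRat E h hj.injective
  essential {Z} g hg := by
    rw [ModuleCat.mono_iff_injective] at hg ⊢
    -- As `ζ_M` factors as `ζ_E` after `j`, the map `L` is injective on the image of `M`. Its range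
    -- is `s`-unital as a quotient of `E`, so `L` becomes a morphism of Doi-Koppinen modules and
    -- essentiality of `j` makes it injective.
    let L : E →ₗ[Smash K H A C] Z := g.hom ∘ₗ (zeta (𝟙 E) h).hom
    have hL : ∀ m, L (Hom.toLin j m) = (zeta j h ≫ g).hom m := fun m => rfl
    obtain ⟨D, ⟨e⟩⟩ := exists_dkMod hC (LinearMap.range L)
      ((E.isSUnital hRat).of_surjective _ L.surjective_rangeRestrict)
    have hk := hj.essential (homOf hC (e.symm.toLinearMap ∘ₗ L.rangeRestrict)) (by
      rw [mono_iff_injective hC hRat]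
      intro a b hab
      apply hg
      rw [comp_apply, comp_apply, homOf_apply, homOf_apply] at hab
      exact congrArg Subtype.val (e.symm.injective hab))
    rw [mono_iff_injective hC hRat] at hk
    have hLinj : Function.Injective L := fun a b hab =>
      hk (congrArg e.symm (Subtype.ext hab))
    -- If `g(φ) = 0`, then `L(φ(r)) = g((1 # r) φ) = 0` for every `r`, hence `φ = 0`.
    refine (injective_iff_map_eq_zero g.hom).2 fun φ hφ => ?_
    refine LinearMap.ext fun r : rat K C (ConvDual K C) => hLinj ?_
    change g.hom ((zeta (𝟙 E) h).hom ((show E.RatHom from φ) r)) = L 0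
    rw [← mk_smul_ratHom, map_smul, hφ, smul_zero, map_zero]

theorem injective_of_injective_toSmash (hC : IsLocallyProjective K C) (hRat : RatIsExact K C)
    {M : DKMod K H A C} (hM : Injective M.toSmash) : Injective M := by
  have := (Module.injective_iff_injective_object (Smash K H A C) M).2 hM
  exact (injective_iff hC hRat M).2 fun X Y _ _ _ _ _ _ i hi f => this.out i hi f

/-- An injective module is isomorphic to its injective envelope, which is given by `ζ`. Conversely
an isomorphism `ζ` transports injectivity from its target. -/
theorem injective_toSmash_iff (hC : IsLocallyProjective K C) (hRat : RatIsExact K C)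
    {M E : DKMod K H A C} (j : M ⟶ E) (h : Function.Bijective E.hatMap) (hj : IsInjectiveHull j) :
    Injective M.toSmash ↔ Injective M ∧ IsIso (zeta j h) := by
  have hz := isInjectiveHull_zeta hC hRat j h hj
  refine ⟨fun hM => ⟨injective_of_injective_toSmash hC hRat hM, hz.isIso hM⟩, fun ⟨_, hi⟩ => ?_⟩
  exact Injective.of_iso (asIso (zeta j h)).symm hz.injective

/-- An injective Doi-Koppinen module with finite support is an injective `A # C*`-module. -/
theorem injective_toSmash_of_hasFiniteSupport (hC : IsLocallyProjective K C)
    (hRat : RatIsExact K C) {M : DKMod K H A C} (h : Function.Bijective M.hatMap)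
    (hM : Injective M) (hfin : HasFiniteSupport K C M) : Injective M.toSmash := by
  obtain ⟨U, hU, F, hFU, hF⟩ := hfin
  set e : ConvDual K C := ∑ e ∈ F, e
  have heT : e ∈ rat K C (ConvDual K C) :=
    Submodule.sum_mem _ fun x hx => hU.subset x (hFU hx)
  have hsurj : Function.Surjective (zeta (𝟙 M) h).hom := by
    intro φ
    let φ' : M.RatHom := φ
    -- The preimage of `φ` is `φ(e)`. A common right unit `w` of `r` and `e` gives `φ(r) = r φ(w)`,
    -- and since `e` acts as the identity on `M`, `φ(w) = e φ(w) = φ(e w) = φ(e)`.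
    refine ⟨φ' ⟨e, heT⟩, LinearMap.ext fun r : rat K C (ConvDual K C) => ?_⟩
    change r.1 • φ' ⟨e, heT⟩ = φ' r
    obtain ⟨e₁, h₁, hr, -⟩ := hU.unit r.1 r.2
    obtain ⟨e₂, h₂, hee, -⟩ := hU.unit e heT
    -- Here `1 - w = (1 - e₁)(1 - e₂)`. The first factor annihilates `r` from the right. The second
    -- annihilates `e`, and commutativity of `e₁` and `e₂` lets it act first.
    let w : rat K C (ConvDual K C) := ⟨e₁, hU.subset _ h₁⟩ + ⟨e₂, hU.subset _ h₂⟩ -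
      ⟨e₁ * e₂, rat_mul_mem (hU.subset _ h₁) e₂⟩
    have hw : w.1 = e₁ + e₂ - e₁ * e₂ := rfl
    have hrw : r.1 * w.1 = r.1 := by
      rw [hw, mul_sub, mul_add, ← mul_assoc, hr]
      abel
    have hew : e * w.1 = e := by
      rw [hw, hU.comm e₁ h₁ e₂ h₂, mul_sub, mul_add, ← mul_assoc, hee]
      abel
    have h1 : φ' r = r.1 • φ' w := by
      rw [← map_smul]
      exact congrArg φ' (Subtype.ext hrw.symm)
    have h2 : φ' w = φ' ⟨e, heT⟩ := by
      rw [← hF (φ' w), ← map_smul]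
      exact congrArg φ' (Subtype.ext hew)
    rw [h1, h2]
  have hiso : IsIso (zeta (𝟙 M) h) := by
    rw [ConcreteCategory.isIso_iff_bijective]
    exact ⟨zeta_injective hRat (𝟙 M) h Function.injective_id, hsurj⟩
  exact Injective.of_iso (asIso (zeta (𝟙 M) h)).symm (injective_ratHom hC hRat M h hM)

end DKMod

/-! ### Restriction of injectivity from `A # C*` to `A` -/

section Swap

variable {K H A C : Type u} [CommRing K] [Ring H] [HopfAlgebra K H]
  [Ring A] [Algebra K A] [RightComoduleAlgebra K H A]
  [AddCommGroup C] [Module K C] [Coalgebra K C] [Module H C] [IsScalarTower K H C]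
  [LeftModuleCoalgebra K H C]

/-- If `θ(h₁ ⊗ h₂) = ε(h)` for all `h`, then `∑ a₀ ⊗ θ(a₁ ⊗ a₂) = a ⊗ 1`. -/
theorem lTensor_coact_coact (θ : H ⊗[K] H →ₗ[K] H)
    (hθ : ∀ h : H, θ (Coalgebra.comul (R := K) h) = Coalgebra.counit (R := K) h • (1 : H)) (a : A) :
    θ.lTensor A (TensorProduct.assoc K A H H
      ((RightComoduleAlgebra.coact (K := K) (H := H) (A := A)).toLinearMap.rTensor H
        (RightComoduleAlgebra.coact (K := K) (H := H) a))) = a ⊗ₜ 1 := by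
  have h1 := LinearMap.congr_fun (RightComoduleAlgebra.coassoc (K := K) (H := H) (A := A)) a
  have h2 := LinearMap.congr_fun (RightComoduleAlgebra.counit_coact (K := K) (H := H) (A := A)) a
  simp only [LinearMap.comp_apply, LinearMap.id_apply, LinearEquiv.coe_coe,
    AlgHom.toLinearMap_apply] at h1 h2
  rw [h1]
  conv_rhs => rw [← h2]
  generalize RightComoduleAlgebra.coact (K := K) (H := H) a = t
  induction t with
  | zero => simp
  | add s t hs ht => simp only [map_add, TensorProduct.add_tmul, hs, ht]
  | tmul a h => simp [hθ, TensorProduct.smul_tmul]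

/-- `∑ s(h₂) h₁ = ε(h)` for the inverse `s` of the antipode. -/
theorem inv_antipode_mul {s : H →ₗ[K] H}
    (hs : ∀ h, HopfAlgebra.antipode K (s h) = h)
    (hinj : Function.Injective (HopfAlgebra.antipode K : H →ₗ[K] H)) (h : H) :
    (LinearMap.mul' K H ∘ₗ s.rTensor H ∘ₗ (TensorProduct.comm K H H).toLinearMap)
      (Coalgebra.comul (R := K) h) = Coalgebra.counit (R := K) h • (1 : H) := by
  -- The antipode reverses products, so it sends `∑ s(h₂) h₁` to `∑ S(h₁) h₂`, where the antipode
  -- axiom applies.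
  apply hinj
  have key : ∀ w : H ⊗[K] H, HopfAlgebra.antipode K
      ((LinearMap.mul' K H ∘ₗ s.rTensor H ∘ₗ (TensorProduct.comm K H H).toLinearMap) w) =
      LinearMap.mul' K H ((HopfAlgebra.antipode K).rTensor H w) := by
    intro w
    induction w with
    | zero => simp
    | add s t hs ht => simp only [map_add, hs, ht]
    | tmul h k => simp [HopfAlgebra.antipode_mul_antidistrib, hs]
  rw [key, HopfAlgebra.mul_antipode_rTensor_comul_apply, map_smul, HopfAlgebra.antipode_one,
    Algebra.algebraMap_eq_smul_one]

/-- `∑ h₂ s(h₁) = ε(h)` for the inverse `s` of the antipode. -/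
theorem mul_inv_antipode {s : H →ₗ[K] H}
    (hs : ∀ h, HopfAlgebra.antipode K (s h) = h)
    (hinj : Function.Injective (HopfAlgebra.antipode K : H →ₗ[K] H)) (h : H) :
    (LinearMap.mul' K H ∘ₗ s.lTensor H ∘ₗ (TensorProduct.comm K H H).toLinearMap)
      (Coalgebra.comul (R := K) h) = Coalgebra.counit (R := K) h • (1 : H) := by
  apply hinj
  have key : ∀ w : H ⊗[K] H, HopfAlgebra.antipode K
      ((LinearMap.mul' K H ∘ₗ s.lTensor H ∘ₗ (TensorProduct.comm K H H).toLinearMap) w) =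
      LinearMap.mul' K H ((HopfAlgebra.antipode K).lTensor H w) := by
    intro w
    induction w with
    | zero => simp
    | add s t hs ht => simp only [map_add, hs, ht]
    | tmul h k => simp [HopfAlgebra.antipode_mul_antidistrib, hs]
  rw [key, HopfAlgebra.mul_antipode_lTensor_comul_apply, map_smul, HopfAlgebra.antipode_one,
    Algebra.algebraMap_eq_smul_one]

variable (K H A C) in
/-- The map `C* ⊗ A → A # C*`, `y ⊗ a ↦ (1 # y)(a # 1) = ∑ a₀ # (y a₁)`. -/
def swapMap : ConvDual K C ⊗[K] A →ₗ[K] A ⊗[K] ConvDual K C :=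
  TensorProduct.lift <| LinearMap.mk₂ K
    (fun y a => (dualAct K H C y).lTensor A (RightComoduleAlgebra.coact (K := K) (H := H) a))
    (fun y y' a => by rw [map_add, LinearMap.lTensor_add, LinearMap.add_apply])
    (fun k y a => by rw [map_smul, LinearMap.lTensor_smul, LinearMap.smul_apply])
    (fun y a a' => by rw [map_add, map_add]) (fun k y a => by rw [map_smul, map_smul])

variable (A C) in
/-- The map `A # C* → C* ⊗ A`, `a # y ↦ ∑ (y s(a₁)) ⊗ a₀`. -/
def swapInv (s : H →ₗ[K] H) : A ⊗[K] ConvDual K C →ₗ[K] ConvDual K C ⊗[K] A :=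
  TensorProduct.lift <| LinearMap.mk₂ K
    (fun a y => (dualAct K H C y ∘ₗ s).rTensor A (TensorProduct.comm K A H
      (RightComoduleAlgebra.coact (K := K) (H := H) a)))
    (fun a a' y => by rw [map_add, map_add, map_add])
    (fun k a y => by rw [map_smul, map_smul, map_smul])
    (fun a y y' => by rw [map_add, LinearMap.add_comp, LinearMap.rTensor_add, LinearMap.add_apply])
    (fun k a y => by
      rw [map_smul, LinearMap.smul_comp, LinearMap.rTensor_smul, LinearMap.smul_apply])

theorem swapMap_tmul (y : ConvDual K C) (a : A) : swapMap K H A C (y ⊗ₜ a) =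
    (dualAct K H C y).lTensor A (RightComoduleAlgebra.coact (K := K) (H := H) a) := rfl

theorem swapInv_tmul (s : H →ₗ[K] H) (y : ConvDual K C) (a : A) : swapInv A C s (a ⊗ₜ y) =
    (dualAct K H C y ∘ₗ s).rTensor A (TensorProduct.comm K A H
      (RightComoduleAlgebra.coact (K := K) (H := H) a)) := rfl

theorem ofTensor_swapMap (y : ConvDual K C) (a : A) :
    Smash.ofTensor K H A C (swapMap K H A C (y ⊗ₜ a)) = Smash.mk K H 1 y * Smash.mk K H a 1 := by
  rw [Smash.mk_mul_mk, swapMap_tmul]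
  congr 1
  refine LinearMap.congr_fun (congrArg₂ TensorProduct.map ?_ ?_) _
  · ext; simp
  · ext; simp [twist_apply]

/-- The composite sends `a # y` to `∑ a₀ # (y s(a₂) a₁)`, and `∑ s(h₂) h₁ = ε(h)` collapses it. -/
theorem swapMap_swapInv {s : H →ₗ[K] H} (hs : ∀ h, HopfAlgebra.antipode K (s h) = h)
    (hinj : Function.Injective (HopfAlgebra.antipode K : H →ₗ[K] H))
    (u : A ⊗[K] ConvDual K C) : swapMap K H A C (swapInv A C s u) = u := by
  induction u with
  | zero => simp
  | add s t hs ht => simp only [map_add, hs, ht]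
  | tmul a y =>
    have h := congrArg ((dualAct K H C y).lTensor A)
      (lTensor_coact_coact _ (inv_antipode_mul hs hinj) a)
    rw [LinearMap.lTensor_tmul, dualAct_one] at h
    refine Eq.trans ?_ h
    rw [swapInv_tmul]
    generalize RightComoduleAlgebra.coact (K := K) (H := H) a = t
    induction t with
    | zero => simp
    | add s t hs ht => simp only [map_add, hs, ht]
    | tmul a h =>
      simp only [TensorProduct.comm_tmul, LinearMap.rTensor_tmul, swapMap_tmul,
        AlgHom.toLinearMap_apply]
      generalize RightComoduleAlgebra.coact (K := K) (H := H) a = t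
      induction t with
      | zero => simp
      | add s t hs ht => simp only [map_add, TensorProduct.add_tmul, hs, ht]
      | tmul a k => simp [dualAct_mul]

/-- The composite sends `y ⊗ a` to `∑ (y a₂ s(a₁)) ⊗ a₀`, and `∑ h₂ s(h₁) = ε(h)` collapses it. -/
theorem swapInv_swapMap {s : H →ₗ[K] H} (hs : ∀ h, HopfAlgebra.antipode K (s h) = h)
    (hinj : Function.Injective (HopfAlgebra.antipode K : H →ₗ[K] H))
    (w : ConvDual K C ⊗[K] A) : swapInv A C s (swapMap K H A C w) = w := by
  induction w with
  | zero => simp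
  | add s t hs ht => simp only [map_add, hs, ht]
  | tmul y a =>
    have h := congrArg (TensorProduct.comm K A (ConvDual K C) ∘ (dualAct K H C y).lTensor A)
      (lTensor_coact_coact _ (mul_inv_antipode hs hinj) a)
    rw [Function.comp_apply, Function.comp_apply, LinearMap.lTensor_tmul, dualAct_one,
      TensorProduct.comm_tmul] at h
    refine Eq.trans ?_ h
    rw [swapMap_tmul]
    generalize RightComoduleAlgebra.coact (K := K) (H := H) a = t
    induction t with
    | zero => simp
    | add s t hs ht => simp only [map_add, hs, ht]
    | tmul a h =>
      simp only [LinearMap.rTensor_tmul, LinearMap.lTensor_tmul, swapInv_tmul,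
        AlgHom.toLinearMap_apply]
      generalize RightComoduleAlgebra.coact (K := K) (H := H) a = t
      induction t with
      | zero => simp
      | add s t hs ht => simp only [map_add, TensorProduct.add_tmul, hs, ht]
      | tmul a k => simp [dualAct_mul]

theorem DKMod.mk_one_smul (M : DKMod K H A C) (a : A) (m : M) :
    Smash.mk K H a (1 : ConvDual K C) • m = a • m := by
  rw [mk_smul, one_smul]

/-- If the antipode is bijective and `C*` is flat, Doi-Koppinen modules which are injective over
`A # C*` are injective over `A`. -/
theorem DKMod.baer_of_injective_toSmash
    (hS : Function.Bijective (HopfAlgebra.antipode K : H →ₗ[K] H))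
    (hflat : Module.Flat K (ConvDual K C)) (M : DKMod K H A C)
    (hM : Module.Injective (Smash K H A C) M) : Module.Baer A M := by
  intro I f
  let s : H →ₗ[K] H := (LinearEquiv.ofBijective _ hS).symm.toLinearMap
  have hs : ∀ h, HopfAlgebra.antipode K (s h) = h :=
    fun h => (LinearEquiv.ofBijective _ hS).apply_symm_apply h
  let lam : I → A ⊗[K] ConvDual K C →ₗ[K] ConvDual K C ⊗[K] I := fun b =>
    ((LinearMap.toSpanSingleton A I b).restrictScalars K).lTensor (ConvDual K C) ∘ₗ swapInv A C s
  let κ : ConvDual K C ⊗[K] I →ₗ[K] A ⊗[K] ConvDual K C :=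
    swapMap K H A C ∘ₗ (I.subtype.restrictScalars K).lTensor (ConvDual K C)
  let g : ConvDual K C ⊗[K] I →ₗ[K] M :=
    TensorProduct.lift (LinearMap.compl₂ M.dualEnd (f.restrictScalars K))
  -- This is where flatness enters: `C* ⊗ I` embeds in `C* ⊗ A ≅ A # C*`, with image the left ideal
  -- generated by the elements `b # 1`, `b ∈ I`.
  have hκ : Function.Injective κ :=
    (Function.LeftInverse.injective (swapInv_swapMap hs hS.1)).comp
      (Module.Flat.lTensor_preserves_injective_linearMap _ I.injective_subtype)
  have h1 : ∀ (b : I) (w : ConvDual K C ⊗[K] A),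
      Smash.ofTensor K H A C (κ (((LinearMap.toSpanSingleton A I b).restrictScalars K).lTensor
        (ConvDual K C) w)) =
        Smash.ofTensor K H A C (swapMap K H A C w) * Smash.mk K H b.1 1 := by
    intro b w
    induction w with
    | zero => simp
    | add s t hs ht => simp only [map_add, add_mul, hs, ht]
    | tmul y a =>
      rw [ofTensor_swapMap, mul_assoc, Smash.mk_one_mul_mk_one, ← ofTensor_swapMap]
      rfl
  have h2 : ∀ (b : I) (w : ConvDual K C ⊗[K] A),
      g (((LinearMap.toSpanSingleton A I b).restrictScalars K).lTensor (ConvDual K C) w) =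
        Smash.ofTensor K H A C (swapMap K H A C w) • f b := by
    intro b w
    induction w with
    | zero => simp
    | add s t hs ht => simp only [map_add, add_smul, hs, ht]
    | tmul y a =>
      rw [ofTensor_swapMap, mul_smul, mk_one_smul, dual_smul_eq, ← map_smul]
      rfl
  -- The left ideal generated by `I` is presented by generators: `Φ` maps onto it, and `Ψ` is the
  -- candidate for the induced map to `M`. Both factor through `Λ`, as `κ ∘ Λ` and `g ∘ Λ`, so
  -- injectivity of `κ` gives `ker Φ ≤ ker Ψ`.
  let Φ : (I →₀ Smash K H A C) →ₗ[Smash K H A C] Smash K H A C :=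
    Finsupp.linearCombination _ fun b => Smash.mk K H b.1 1
  let Ψ : (I →₀ Smash K H A C) →ₗ[Smash K H A C] M := Finsupp.linearCombination _ f
  let Λ : (I →₀ Smash K H A C) →+ ConvDual K C ⊗[K] I :=
    Finsupp.liftAddHom fun b => (lam b).toAddMonoidHom
  have hΛ : ∀ b u, Λ (Finsupp.single b u) = lam b u :=
    fun b u => Finsupp.liftAddHom_apply_single _ b u
  have hΦ : ∀ w, Smash.ofTensor K H A C (κ (Λ w)) = Φ w := by
    intro w
    induction w using Finsupp.induction_linear with
    | zero => simp
    | add v w hv hw => simp only [map_add, hv, hw]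
    | single b u =>
      rw [hΛ, Finsupp.linearCombination_single]
      exact (h1 b (swapInv A C s u)).trans
        (congrArg (Smash.ofTensor K H A C · * Smash.mk K H b.1 1) (swapMap_swapInv hs hS.1 u))
  have hΨ : ∀ w, g (Λ w) = Ψ w := by
    intro w
    induction w using Finsupp.induction_linear with
    | zero => simp
    | add v w hv hw => simp only [map_add, hv, hw]
    | single b u =>
      rw [hΛ, Finsupp.linearCombination_single]
      exact (h2 b (swapInv A C s u)).trans
        (congrArg (Smash.ofTensor K H A C · • f b) (swapMap_swapInv hs hS.1 u))
  have hker : LinearMap.ker Φ ≤ LinearMap.ker Ψ := by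
    intro w hw
    have h0 : κ (Λ w) = κ 0 := by
      rw [map_zero]
      exact (Smash.ofTensor K H A C).injective ((hΦ w).trans hw)
    change Ψ w = 0
    rw [← hΨ, hκ h0, map_zero]
  -- The induced map on the left ideal extends to `h : A # C* → M` with `h(b # 1) = f(b)`, and `a ↦
  -- a h(1)` is the required extension of `f`.
  obtain ⟨h, hh⟩ := hM.out ((LinearMap.ker Φ).liftQ Φ le_rfl)
    (LinearMap.ker_eq_bot.1 (Submodule.ker_liftQ_eq_bot _ _ _ le_rfl))
    ((LinearMap.ker Φ).liftQ Ψ hker)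
  refine ⟨LinearMap.toSpanSingleton A M (h 1), fun b hb => ?_⟩
  have := hh (Submodule.Quotient.mk (Finsupp.single ⟨b, hb⟩ 1))
  rw [Submodule.liftQ_apply, Submodule.liftQ_apply, Finsupp.linearCombination_single,
    Finsupp.linearCombination_single, one_smul, one_smul] at this
  rw [LinearMap.toSpanSingleton_apply, ← mk_one_smul, ← map_smul, smul_eq_mul, mul_one, this]

end Swap

end DoiKoppinen

end

/-! ### The main theorem -/

open DoiKoppinen in
theorem mainTheorem6 {K H A C : Type u} [CommRing K] [Ring H] [HopfAlgebra K H]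
    [Ring A] [Algebra K A] [RightComoduleAlgebra K H A]
    [AddCommGroup C] [Module K C] [Coalgebra K C] [Module H C] [IsScalarTower K H C]
    [LeftModuleCoalgebra K H C]
    (hC : IsLocallyProjective K C) (hA : Module.Flat K A) (hRat : RatIsExact K C) :
    ∃ hat : ∀ E : DKMod K H A C, Function.Bijective E.hatMap,
      ∀ M : DKMod K H A C,
        (∃ (E : DKMod K H A C) (j : M ⟶ E), IsInjectiveHull j) ∧
        (∀ (E : DKMod K H A C) (j : M ⟶ E), IsInjectiveHull j →
          IsInjectiveHull (DKMod.zeta j (hat E)) ∧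
          (Injective M.toSmash ↔ Injective M ∧ IsIso (DKMod.zeta j (hat E)))) ∧
        (Function.Bijective (HopfAlgebra.antipode K : H →ₗ[K] H) →
          Module.Flat K (Module.Dual K C) → Injective M → HasFiniteSupport K C M →
          Injective M.toA) := by
  refine ⟨DKMod.hatMap_bijective hA hRat, fun M => ⟨DKMod.exists_injectiveHull hC hRat M,
    fun E j hj => ⟨DKMod.isInjectiveHull_zeta hC hRat j _ hj,
      DKMod.injective_toSmash_iff hC hRat j _ hj⟩, fun hS hflat hM hfin => ?_⟩⟩
  have hinj := DKMod.injective_toSmash_of_hasFiniteSupport hC hRat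
    (DKMod.hatMap_bijective hA hRat M) hM hfin
  have hflat' : Module.Flat K (ConvDual K C) :=
    Module.Flat.of_linearEquiv (WithConv.linearEquiv K (C →ₗ[K] K))
  exact (Module.injective_iff_injective_object A M).1 (DKMod.baer_of_injective_toSmash hS hflat' M
    ((Module.injective_iff_injective_object (Smash K H A C) M).2 hinj)).injective
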